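/- Let $\mathfrak g=\mathfrak{so}(2r)$, $r\ge 4$, be the simple Lie algebra of type $\mathrm D_r$, with simple roots $\alpha_1,\dots,\alpha_r$, fundamental weights $\omega_1,\dots,\omega_r$, and the invariant form on $\mathfrak h^*$ normalized by $(\alpha_i,\alpha_i)=2$; thus $(\alpha_i,\alpha_{i+1})=-1$ for $1\le i\le r-2$, $(\alpha_{r-2},\alpha_r)=-1$, and $(\alpha_i,\alpha_j)=0$ for all other $i\neq j$. Let $\lambda=\sum_i\lambda_i\omega_i$ be a dominant integral weight, $\lambda_i\in\mathbb Z_{\ge 0}$. For $\boldsymbol l=(l_1,\dots,l_r)\in\mathbb Z_{\ge0}^r$ put $\alpha(\boldsymbol l)=\sum_i l_i\alpha_i$, and take $l_1+\dots+l_r$ complex variables $t_p$, of which $l_i$ have color $i$; write $c(p)$ for the color of $t_p$. The Bethe ansatz equation associated to $\boldsymbol\Lambda=(\lambda,\omega_1)$, $\boldsymbol z=(0,1)$, $\boldsymbol l$ is the system $$-\frac{(\alpha_{c(p)},\lambda)}{t_p}-\frac{(\alpha_{c(p)},\omega_1)}{t_p-1}+\sum_{q\ne p}\frac{(\alpha_{c(p)},\alpha_{c(q)})}{t_p-t_q}=0\qquad\text{for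 all }p,$$ where terms with zero numerator are omitted and the denominators of all other terms are required to be nonzero. Solutions that differ by a permutation of variables of the same color are identified; a solution is represented by the monic polynomials $y_i(x)=\prod_{c(p)=i}(x-t_p)$, $i=1,\dots,r$. Consider the following tuples $\boldsymbol l$, labelled by their lengths $l\in\{0,1,\dots,r-1,\overline{r-1},r,\dots,2r-2\}$: for $0\le l\le r-1$, $\boldsymbol l=(1,\dots,1,0,\dots,0)$ with $l$ ones; for $l=\overline{r-1}$, $\boldsymbol l=(1,\dots,1,0,1)$; for $r\le l\le 2r-2$, $\boldsymbol l=(1,\dots,1,2,\dots,2,1,1)$, starting with $2r-2-l$ ones followed by $l-r$ twos (so $\boldsymbol l=(1,\dots,1)$ for $l=r$). Call $l$ admissible if $V_{\lambda+\omega_1-\alpha(\boldsymbol l)}$ occurs in the decomposition of $V_\lambda\otimes V_{\omega_1}$ into irreducible modules, i.e. if the weight $\lambda+\omega_1-\alpha(\boldsymbol l)$ is dominant. **Theorem.** If $l$ is not admissible, the Bethe ansatz equation associated to $\boldsymbol\Lambda,\boldsymbol z,\boldsymbol l$ has no solutions. If $l$ is admissible, it has exactly one solution, and this solution is represented by the following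 $r$-tuple $\boldsymbol y^{(l)}$. Write $\varrho(x)=\frac{x}{x+1}$; empty sums are $0$ and empty products are $1$. * For $0\le l\le r-1$: $\boldsymbol y^{(l)}=(x-c_1,\dots,x-c_l,1,\dots,1)$, $\;c_j=\prod_{i=1}^j\varrho(\lambda_i+\dots+\lambda_l+l-i)$. * For $l=\overline{r-1}$: $\boldsymbol y^{(l)}=(x-c_1,\dots,x-c_{r-2},1,x-c_r)$, where $c_j=\prod_{i=1}^j\varrho(\lambda_i+\dots+\lambda_{r-2}+\lambda_r+r-1-i)$ for $j\le r-2$, and $c_r=\varrho(\lambda_r)\,c_{r-2}$. * For $l=r$: $\boldsymbol y^{(l)}=(x-c_1,\dots,x-c_r)$, where $c_j=\prod_{i=1}^j\varrho(\lambda_i+\dots+\lambda_r+r-i)$ for $j\le r-2$, $c_{r-1}=\varrho(\lambda_{r-1})\,c_{r-2}$, and $c_r=\varrho(\lambda_r)\,c_{r-2}$. * For $r+1\le l\le 2r-2$, put $m=2r-1-l$ and $$P_j=\prod_{i=1}^{j}\varrho\big(\lambda_i+\dots+\lambda_{m-1}+2\lambda_m+\dots+2\lambda_{r-2}+\lambda_{r-1}+\lambda_r+l-i\big),$$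 $$Q_{a,b}=\prod_{i=a}^{b}\varrho\big(\lambda_m+\dots+\lambda_i+2\lambda_{i+1}+\dots+2\lambda_{r-2}+\lambda_{r-1}+\lambda_r+l-i-1\big),$$ $$R_k=\prod_{i=k}^{r-2}\varrho\big(\lambda_m+\dots+\lambda_i+l+i+1-2r\big),\qquad E_s=\varrho\big(\lambda_m+\dots+\lambda_{r-2}+\lambda_s+l-r\big)\ (s=r-1,r),$$ $$M=2\lambda_m+\dots+2\lambda_{r-2}+\lambda_{r-1}+\lambda_r+2l-2r.$$ Then $$\boldsymbol y^{(l)}=\big(x-c_1,\dots,x-c_{m-1},(x-a_m)(x-b_m),\dots,(x-a_{r-2})(x-b_{r-2}),x-c_{r-1},x-c_r\big),$$ where $c_j=P_j$ for $j\le m-1$, $c_s=P_{m-1}Q_{m,r-2}E_s$ for $s=r-1,r$, and for $m\le k\le r-2$ $$a_kb_k=P_{m-1}^2\,Q_{m,r-2}\,Q_{m,k-1}\,R_k\,E_{r-1}E_r,$$ $$a_k+b_k=P_{m-1}\,Q_{m,k-1}\left(\frac{M}{M+1}+\frac{M+2}{M+1}\,Q_{k,r-2}\,E_{r-1}E_r\,R_k\right).$$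 -/

import Mathlib

open Polynomial

noncomputable section

namespace BetheAnsatz

/-! ### Weights

A weight `Λ ∈ 𝔥*` of a simple Lie algebra of rank `r` with Cartan matrix `A = (a i j)` is given by
its Dynkin labels `Λ i = ⟨Λ, αᵢ^∨⟩`, that is, by its coordinates in the basis of fundamental
weights.  `d` is the vector of positive integers such that `diag(d) * A` is symmetric. -/

/-- The dual `𝔥*` of the Cartan subalgebra, in the basis of fundamental weights. -/
abbrev Weight (r : ℕ) : Type := Fin r → ℂ

/-- The simple root `α j`, with labels `⟨α j, αᵢ^∨⟩ = a i j`. -/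
def simpleRoot {r : ℕ} (A : Matrix (Fin r) (Fin r) ℤ) (j : Fin r) : Weight r :=
  fun i => (A i j : ℂ)

/-- The value `(α i, Λ) = d i * ⟨Λ, αᵢ^∨⟩` of the invariant form on `𝔥*`, normalized by
`(α i, α j) = d i * a i j`. -/
def rootForm {r : ℕ} (d : Fin r → ℕ) (i : Fin r) (Λ : Weight r) : ℂ :=
  (d i : ℂ) * Λ i

/-- `Λ ∈ 𝒫⁺`: all labels are nonnegative integers. -/
def IsDominantIntegral {r : ℕ} (Λ : Weight r) : Prop :=
  ∀ i, ∃ n : ℕ, Λ i = (n : ℂ)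

/-! ### The Bethe ansatz equation -/

/-- The index set of the variables: `l i` variables of color `i`, for every `i`. -/
abbrev Var {r : ℕ} (l : Fin r → ℕ) : Type := Σ i : Fin r, Fin (l i)

/-- `t` is a critical point of the master function associated to `Λ`, `z`, `l`, that is, a solution
of the Bethe ansatz equation
`- ∑ s, (α c(p), Λ s) / (t p - z s) + ∑ q ≠ p, (α c(p), α c(q)) / (t p - t q) = 0` for all `p`,
where `c(p)` is the color of the variable `p`.  A term with zero numerator is absent; the
denominators of all the other terms have to be nonzero. -/
def IsCriticalPoint {r n : ℕ} (A : Matrix (Fin r) (Fin r) ℤ) (d : Fin r → ℕ)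
    (Λ : Fin n → Weight r) (z : Fin n → ℂ) (l : Fin r → ℕ) (t : Var l → ℂ) : Prop :=
  (∀ (p : Var l) (s : Fin n), rootForm d p.1 (Λ s) ≠ 0 → t p ≠ z s) ∧
  (∀ p q : Var l, p ≠ q → rootForm d p.1 (simpleRoot A q.1) ≠ 0 → t p ≠ t q) ∧
  (∀ p : Var l,
    -(∑ s : Fin n, rootForm d p.1 (Λ s) / (t p - z s))
      + ∑ q ∈ Finset.univ.erase p, rootForm d p.1 (simpleRoot A q.1) / (t p - t q) = 0)

/-- Two points lie in the same orbit of the group of color preserving permutations of the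
variables. -/
def SameOrbit {r : ℕ} {l : Fin r → ℕ} (t t' : Var l → ℂ) : Prop :=
  ∃ σ : ∀ i : Fin r, Equiv.Perm (Fin (l i)), ∀ (i : Fin r) (a : Fin (l i)),
    t' ⟨i, a⟩ = t ⟨i, σ i a⟩

/-- The `r`-tuple of polynomials `y i = ∏ (x - t p)`, over the variables `p` of color `i`. -/
def representingPoly {r : ℕ} {l : Fin r → ℕ} (t : Var l → ℂ) (i : Fin r) : ℂ[X] :=
  ∏ a : Fin (l i), (X - C (t ⟨i, a⟩))

/-! ### Type `D r`, `𝔤 = 𝔰𝔬(2r)`, with the data `(λ, ω₁)` and `z = (0, 1)` -/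

/-- The fundamental weight `ω₁`. -/
def omegaOne (r : ℕ) : Weight r := fun i => if i.val = 0 then 1 else 0

/-- The Bethe ansatz equation of type `D r` (where all `d i = 1`) associated to the weights
`(λ, ω₁)`, the points `(0, 1)` and `l`. -/
def IsSolutionD {r : ℕ} (lam : Weight r) (l : Fin r → ℕ) (t : Var l → ℂ) : Prop :=
  IsCriticalPoint (CartanMatrix.D r) (fun _ => 1) ![lam, omegaOne r] ![0, 1] l t

/-- The lengths `0, 1, …, r - 1, r, …, 2r - 2`, and the additional length `\overline{r-1}`. -/
inductive LengthD (r : ℕ) : Type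
  | ord (l : ℕ) (hl : l ≤ 2 * r - 2) : LengthD r
  | bar : LengthD r

/-- The `r`-tuple `(l₁, …, l_r)` of a given length:
`(1,…,1,0,…,0)` with `l` ones if `l ≤ r - 1`, `(1,…,1,0,1)` for `\overline{r-1}`, and
`(1,…,1,2,…,2,1,1)` starting with `2r - 2 - l` ones if `r ≤ l ≤ 2r - 2`
(this is `(1,…,1)` if `l = r`). The color `i.val + 1` is counted from `1`. -/
def LengthD.tuple {r : ℕ} : LengthD r → Fin r → ℕ
  | .ord l _ => fun i =>
      if l ≤ r - 1 then (if i.val + 1 ≤ l then 1 else 0)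
      else if i.val + 1 ≤ 2 * r - 2 - l then 1
      else if i.val + 1 ≤ r - 2 then 2
      else 1
  | .bar => fun i => if i.val + 1 = r - 1 then 0 else 1

/-- A length is admissible if the summand `V_{λ + ω₁ - α(l)}`, `α(l) = ∑ l j α j`, is present in the
decomposition of `V_λ ⊗ V_{ω₁}` (for `λ ∈ 𝒫⁺`): among the weights `λ + ω₁ - α(l)`, for `l` one of
the tuples above, precisely the dominant ones occur. -/
def IsAdmissible {r : ℕ} (lam : Weight r) (L : LengthD r) : Prop :=
  IsDominantIntegral
    (lam + omegaOne r - ∑ j : Fin r, (L.tuple j : ℂ) • simpleRoot (CartanMatrix.D r) j)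

/-! ### The explicit formulas

Below, colors are counted from `1` to `r`. -/

section Formulas

variable {r : ℕ} (lam : Weight r)

/-- The label `λ_i`, for `i = 1, …, r`. -/
def lab (i : ℕ) : ℂ := if h : 1 ≤ i ∧ i ≤ r then lam ⟨i - 1, by omega⟩ else 0

/-- The sum `λ_a + λ_{a+1} + … + λ_b` (zero if `b < a`). -/
def labSum (a b : ℕ) : ℂ := ∑ j ∈ Finset.Icc a b, lab lam j

/-- The fraction `x / (x + 1)`; all factors in the product formulas are of this form. -/
def ratio (x : ℂ) : ℂ := x / (x + 1)

/-- `c_j^{(l)}` for `1 ≤ j ≤ l ≤ r - 1`. -/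
def cLow (l j : ℕ) : ℂ :=
  ∏ i ∈ Finset.Icc 1 j, ratio (labSum lam i l + l - i)

/-- The product `∏_{i=1}^j` in the formulas for the length `\overline{r-1}`. -/
def prodBar (j : ℕ) : ℂ :=
  ∏ i ∈ Finset.Icc 1 j, ratio (labSum lam i (r - 2) + lab lam r + r - 1 - i)

/-- The product `∏_{i=1}^j` in the formulas for the length `r`. -/
def prodMid (j : ℕ) : ℂ :=
  ∏ i ∈ Finset.Icc 1 j, ratio (labSum lam i r + r - i)

/-- `∏_{i=1}^j` of the ratios with numerator
`λ_i + … + λ_{2r-2-l} + 2λ_{2r-1-l} + … + 2λ_{r-2} + λ_{r-1} + λ_r + l - i`, for `l ≥ r + 1`. -/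
def prodHigh₁ (l j : ℕ) : ℂ :=
  ∏ i ∈ Finset.Icc 1 j,
    ratio (labSum lam i (2 * r - 2 - l) + 2 * labSum lam (2 * r - 1 - l) (r - 2)
      + lab lam (r - 1) + lab lam r + l - i)

/-- `∏_{i=a}^b` of the ratios with numerator
`λ_{2r-1-l} + … + λ_i + 2λ_{i+1} + … + 2λ_{r-2} + λ_{r-1} + λ_r + l - i - 1`, for `l ≥ r + 1`. -/
def prodHigh₂ (l a b : ℕ) : ℂ :=
  ∏ i ∈ Finset.Icc a b,
    ratio (labSum lam (2 * r - 1 - l) i + 2 * labSum lam (i + 1) (r - 2)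
      + lab lam (r - 1) + lab lam r + l - i - 1)

/-- `∏_{i=a}^b` of the ratios with numerator `λ_{2r-1-l} + … + λ_i + l + i + 1 - 2r`,
for `l ≥ r + 1`. -/
def prodHigh₃ (l a b : ℕ) : ℂ :=
  ∏ i ∈ Finset.Icc a b, ratio (labSum lam (2 * r - 1 - l) i + l + i + 1 - 2 * r)

/-- The ratio with numerator `λ_{2r-1-l} + … + λ_{r-2} + λ_s + l - r`, where `s` is `r - 1`
or `r`, for `l ≥ r + 1`. -/
def ratioHigh (l s : ℕ) : ℂ :=
  ratio (labSum lam (2 * r - 1 - l) (r - 2) + lab lam s + l - r)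

/-- `c_s^{(l)}` for `s = r - 1` and `s = r`, for `l ≥ r + 1`. -/
def cHigh (l s : ℕ) : ℂ :=
  prodHigh₁ lam l (2 * r - 2 - l) * prodHigh₂ lam l (2 * r - 1 - l) (r - 2) * ratioHigh lam l s

/-- `a_k^{(l)} b_k^{(l)}`, for `l ≥ r + 1`. -/
def abProd (l k : ℕ) : ℂ :=
  prodHigh₁ lam l (2 * r - 2 - l) ^ 2 * prodHigh₂ lam l (2 * r - 1 - l) (r - 2)
    * prodHigh₂ lam l (2 * r - 1 - l) (k - 1) * prodHigh₃ lam l k (r - 2)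
    * (ratioHigh lam l (r - 1) * ratioHigh lam l r)

/-- `2λ_{2r-1-l} + … + 2λ_{r-2} + λ_{r-1} + λ_r + 2l - 2r`. -/
def abNum (l : ℕ) : ℂ :=
  2 * labSum lam (2 * r - 1 - l) (r - 2) + lab lam (r - 1) + lab lam r + 2 * l - 2 * r

/-- `a_k^{(l)} + b_k^{(l)}`, for `l ≥ r + 1`. -/
def abSum (l k : ℕ) : ℂ :=
  prodHigh₁ lam l (2 * r - 2 - l) * prodHigh₂ lam l (2 * r - 1 - l) (k - 1)
    * (abNum lam l / (abNum lam l + 1)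
      + (abNum lam l + 2) / (abNum lam l + 1) * prodHigh₂ lam l k (r - 2)
        * (ratioHigh lam l (r - 1) * ratioHigh lam l r) * prodHigh₃ lam l k (r - 2))

/-- The component `y_k`, `1 ≤ k ≤ r`, of the explicit `r`-tuple of polynomials of a given length.
The quadratic components `(x - a)(x - b)` are given by `a + b` and `ab`. -/
def explicitPoly : LengthD r → ℕ → ℂ[X]
  | .ord l _, k =>
      if l ≤ r - 1 then
        (if k ≤ l then X - C (cLow lam l k) else 1)
      else if l = r then
        (if k ≤ r - 2 then X - C (prodMid lam k)
          else X - C (ratio (lab lam k) * prodMid lam (r - 2)))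
      else if k ≤ 2 * r - 2 - l then X - C (prodHigh₁ lam l k)
      else if k ≤ r - 2 then X ^ 2 - C (abSum lam l k) * X + C (abProd lam l k)
      else X - C (cHigh lam l k)
  | .bar, k =>
      if k ≤ r - 2 then X - C (prodBar lam k)
      else if k = r - 1 then 1
      else X - C (ratio (lab lam r) * prodBar lam (r - 2))

end Formulas

end BetheAnsatz

end

/-! The variables are eliminated color by color along the Dynkin diagram. A single root x with
weight e at the origin and one neighbouring root v satisfies e/x + 1/(x - v) = 0, so x = e/(e + 1) v
(`leaf_iff`). It acts back on v as an additional weight e + 1 at the origin (`one_div_sub_ratio`). A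
chain of single roots is therefore solved from its far end back to the point 1 (`headSystem_iff`).

For a color with two roots a, b put y = (x - a)(x - b), let Λ be its total weight at the origin and
f = (x - v)(x - c)(x - d) the product of the neighbouring polynomials. The two Bethe equations give
a partner x^(Λ+1) (x - u) whose Wronskian with y is Λ x^Λ f (`exists_reproduction`); this is one
step of the reproduction procedure, with x^Λ cancelled. At a root of f different from a and b, y and
its partner have the same logarithmic derivative, so the next color sees a weight Λ + 1 at the
origin and the single root u instead of y. Iterating this from the root T before the first pair
reduces the fork to two leaves attached to one point.

On the way back, every pair has the shape c + d = (M + (M + 2)B)/(M + 1) u, cd = B u², with one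
constant M for the whole tail. The reproduction identity propagates this shape and determines u as a
multiple of v (`Reproduction.solve`). The first pair acts on T as a weight M + 2
(`TailSolution.pairLog_start`), which is all that the preceding single roots feel.

The divisions are legitimate because B is real with 0 < B < 1 and the discriminants are nonzero
(`exists_real_tailProd`). Roots at the origin are excluded by multiplying each equation by its
variable and adding (`TailSystem.sum_mul_incoming`). The weights that must not vanish are exactly
the labels that decide whether λ + ω₁ - α(l) is dominant. Every step is an equivalence, so the
solutions are the points representing the explicit polynomials, and these form one orbit. -/

noncomputable section

namespace BetheAnsatz


/-! ### The reproduction identity for a pair of roots -/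

/-- The logarithmic derivative of `(x - a) (x - b)`. -/
def pairLog (a b x : ℂ) : ℂ := 1 / (x - a) + 1 / (x - b)

/-- The coefficients of
`(Λ + 1) y h + x (y h' - y' h) = Λ (x - v) (x - c) (x - d)`, where `y = (x - a) (x - b)` and
`h = x - u`. -/
structure Reproduction (Λ a b u v c d : ℂ) : Prop where
  coeff_two : (Λ + 1) * (a + b) + (Λ - 1) * u = Λ * (v + c + d)
  coeff_one : (Λ + 2) * (a * b) + Λ * (a + b) * u = Λ * (c * d + v * (c + d))
  coeff_zero : (Λ + 1) * (a * b) * u = Λ * (v * c * d)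

theorem cubic_eq_zero_of_double_roots {a b f₃ f₂ f₁ f₀ : ℂ} (hab : a ≠ b)
    (ha : f₃ * a ^ 3 + f₂ * a ^ 2 + f₁ * a + f₀ = 0)
    (hb : f₃ * b ^ 3 + f₂ * b ^ 2 + f₁ * b + f₀ = 0)
    (ha' : 3 * f₃ * a ^ 2 + 2 * f₂ * a + f₁ = 0)
    (hb' : 3 * f₃ * b ^ 2 + 2 * f₂ * b + f₁ = 0) :
    f₃ = 0 ∧ f₂ = 0 ∧ f₁ = 0 ∧ f₀ = 0 := by
  have hs : a - b ≠ 0 := sub_ne_zero.2 hab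
  have h₃ : f₃ = 0 := by
    have : f₃ * (a - b) ^ 3 = 0 := by
      linear_combination (a - b) * ha' + (a - b) * hb' - 2 * ha + 2 * hb
    simpa [hs] using this
  subst h₃
  have h₂ : f₂ = 0 := by
    have : f₂ * (a - b) = 0 := by linear_combination (ha' - hb') / 2
    simpa [hs] using this
  subst h₂
  have h₁ : f₁ = 0 := by linear_combination ha'
  subst h₁
  exact ⟨rfl, rfl, rfl, by linear_combination ha⟩

namespace Reproduction

variable {Λ a b u v c d : ℂ}

theorem identity (h : Reproduction Λ a b u v c d) (x : ℂ) :
    (Λ + 1) * ((x - a) * (x - b)) * (x - u)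
      + x * ((x - a) * (x - b) - ((x - a) + (x - b)) * (x - u))
      = Λ * ((x - v) * (x - c) * (x - d)) := by
  linear_combination (-x ^ 2) * h.coeff_two + x * h.coeff_one - h.coeff_zero

theorem symm (h : Reproduction Λ a b u v c d) : Reproduction Λ b a u v c d :=
  ⟨by linear_combination h.coeff_two, by linear_combination h.coeff_one,
    by linear_combination h.coeff_zero⟩

/-- The logarithmic derivative of `y` at a root of the right hand side. -/
theorem transfer (h : Reproduction Λ a b u v c d) {w : ℂ} (hw : w = v ∨ w = c ∨ w = d)
    (hw₀ : w ≠ 0) (ha : w ≠ a) (hb : w ≠ b) :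
    w ≠ u ∧ pairLog a b w = (Λ + 1) / w + 1 / (w - u) := by
  have hN : (w - v) * (w - c) * (w - d) = 0 := by
    rcases hw with rfl | rfl | rfl <;> ring
  have key := h.identity w
  rw [hN] at key
  have ha' := sub_ne_zero.2 ha
  have hb' := sub_ne_zero.2 hb
  -- At a common zero of x - u and the right hand side only the term x y h' survives in the
  -- identity.
  have hu : w ≠ u := by
    rintro rfl
    have : w * ((w - a) * (w - b)) = 0 := by linear_combination key
    simp_all
  refine ⟨hu, ?_⟩
  have hu' := sub_ne_zero.2 hu
  rw [pairLog]
  field_simp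
  linear_combination -key

/-- The Bethe ansatz equation at a root of `y`. -/
theorem bethe (h : Reproduction Λ a b u v c d) (hΛ : Λ ≠ 0) (ha₀ : a ≠ 0) (hab : a ≠ b)
    (hv : a ≠ v) (hc : a ≠ c) (hd : a ≠ d) :
    Λ / a + 1 / (a - v) + pairLog c d a - 2 / (a - b) = 0 := by
  have h₀ := h.identity a
  have hab' := sub_ne_zero.2 hab
  have hv' := sub_ne_zero.2 hv
  have hc' := sub_ne_zero.2 hc
  have hd' := sub_ne_zero.2 hd
  -- The derivative of the reproduction identity at a; dividing it by the identity itself at a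
  -- yields the Bethe equation.
  have h₁ : (Λ * (a - b) - 2 * a) * (a - u)
      = Λ * ((a - c) * (a - d) + (a - v) * (a - d) + (a - v) * (a - c)) := by
    linear_combination (-2 * a) * h.coeff_two + h.coeff_one
  have hu : a - u ≠ 0 := by
    intro hu
    rw [hu] at h₀
    have : Λ * ((a - v) * (a - c) * (a - d)) = 0 := by linear_combination -h₀
    simp_all
  rw [pairLog]
  have : (a - u) * (Λ / a + 1 / (a - v) + (1 / (a - c) + 1 / (a - d)) - 2 / (a - b)) = 0 := by
    field_simp
    linear_combination ((a - v) * (a - c) * (a - d)) * h₁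
      - ((a - c) * (a - d) + (a - v) * (a - d) + (a - v) * (a - c)) * h₀
  exact (mul_eq_zero.1 this).resolve_left hu

/-- If `v ≠ 0` and `c`, `d` are nonzero, then so is `u`. -/
theorem u_ne_zero (h : Reproduction Λ a b u v c d) (hΛ : Λ ≠ 0) (hv : v ≠ 0) (hc : c ≠ 0)
    (hd : d ≠ 0) : u ≠ 0 := by
  rintro rfl
  have : Λ * (v * c * d) = 0 := by linear_combination -h.coeff_zero
  simp_all

/-- A root `0` on the right hand side forces `u = 0`. -/
theorem u_eq_zero (h : Reproduction Λ a b u v 0 d) (hΛ : Λ + 1 ≠ 0) (ha : a ≠ 0) (hb : b ≠ 0) :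
    u = 0 := by
  have : (Λ + 1) * (a * b) * u = 0 := by linear_combination h.coeff_zero
  simp_all

theorem second_ne_zero (h : Reproduction Λ a b u v 0 d) (hΛ : Λ + 1 ≠ 0) (hΛ' : Λ + 2 ≠ 0)
    (ha : a ≠ 0) (hb : b ≠ 0) : d ≠ 0 := by
  have hu := h.u_eq_zero hΛ ha hb
  subst hu
  rintro rfl
  have : (Λ + 2) * (a * b) = 0 := by linear_combination h.coeff_one
  simp_all

theorem swap (h : Reproduction Λ a b u v c d) : Reproduction Λ a b u v d c :=
  ⟨by linear_combination h.coeff_two, by linear_combination h.coeff_one,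
    by linear_combination h.coeff_zero⟩

end Reproduction

theorem bethe_polynomial {Λ a b v c d : ℂ} (ha₀ : a ≠ 0) (hab : a ≠ b)
    (hv : a ≠ v) (hc : a ≠ c) (hd : a ≠ d)
    (h : Λ / a + 1 / (a - v) + pairLog c d a - 2 / (a - b) = 0) :
    (Λ * (a - b) - 2 * a) * ((a - v) * (a - c) * (a - d))
      + a * (a - b) * ((a - c) * (a - d) + (a - v) * (a - d) + (a - v) * (a - c)) = 0 := by
  have hab' := sub_ne_zero.2 hab
  have hv' := sub_ne_zero.2 hv
  have hc' := sub_ne_zero.2 hc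
  have hd' := sub_ne_zero.2 hd
  rw [pairLog] at h
  field_simp at h
  linear_combination h

/-- The Bethe ansatz equations for a pair of roots imply the reproduction identity. -/
theorem exists_reproduction {Λ a b v c d : ℂ} (hΛ : Λ ≠ 0) (ha₀ : a ≠ 0) (hb₀ : b ≠ 0)
    (hab : a ≠ b)
    (hav : a ≠ v) (hac : a ≠ c) (had : a ≠ d) (hbv : b ≠ v) (hbc : b ≠ c) (hbd : b ≠ d)
    (ha : Λ / a + 1 / (a - v) + pairLog c d a - 2 / (a - b) = 0)
    (hb : Λ / b + 1 / (b - v) + pairLog c d b - 2 / (b - a) = 0) :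
    ∃ u, Reproduction Λ a b u v c d := by
  have hpa := bethe_polynomial ha₀ hab hav hac had ha
  have hpb := bethe_polynomial hb₀ hab.symm hbv hbc hbd hb
  have hs := sub_ne_zero.2 hab
  -- p and q are the values at a and b that a linear polynomial s x + t must have for the identity
  -- to hold at these two points.
  obtain ⟨p, hp⟩ : ∃ p, a * (a - b) * p = -Λ * ((a - v) * (a - c) * (a - d)) :=
    ⟨-Λ * ((a - v) * (a - c) * (a - d)) / (a * (a - b)), by field_simp⟩
  obtain ⟨q, hq⟩ : ∃ q, b * (a - b) * q = Λ * ((b - v) * (b - c) * (b - d)) :=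
    ⟨Λ * ((b - v) * (b - c) * (b - d)) / (b * (a - b)), by field_simp⟩
  obtain ⟨s, hps⟩ : ∃ s, p - q = s * (a - b) := ⟨(p - q) / (a - b), by field_simp⟩
  obtain ⟨t, ht⟩ : ∃ t, p = s * a + t := ⟨p - s * a, by ring⟩
  have htb : q = s * b + t := by linear_combination ht - hps
  -- The Bethe equation at a is the derivative of the identity at a; likewise below at b.
  have hda : (Λ * (a - b) - 2 * a) * p
      = Λ * ((a - c) * (a - d) + (a - v) * (a - d) + (a - v) * (a - c)) := by
    have : a * (a - b) * ((Λ * (a - b) - 2 * a) * p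
      - Λ * ((a - c) * (a - d) + (a - v) * (a - d) + (a - v) * (a - c))) = 0 := by
      linear_combination (Λ * (a - b) - 2 * a) * hp - Λ * hpa
    exact sub_eq_zero.1 ((mul_eq_zero.1 this).resolve_left (mul_ne_zero ha₀ hs))
  have hdb : (Λ * (b - a) - 2 * b) * q
      = Λ * ((b - c) * (b - d) + (b - v) * (b - d) + (b - v) * (b - c)) := by
    have : b * (a - b) * ((Λ * (b - a) - 2 * b) * q
      - Λ * ((b - c) * (b - d) + (b - v) * (b - d) + (b - v) * (b - c))) = 0 := by
      linear_combination (Λ * (b - a) - 2 * b) * hq + Λ * hpb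
    exact sub_eq_zero.1 ((mul_eq_zero.1 this).resolve_left (mul_ne_zero hb₀ hs))
  subst htb
  subst ht
  -- With s x + t in place of x - u, the difference of the two sides is a cubic with double zeros at
  -- a and b. Its leading coefficient Λ (s - 1) then gives s = 1.
  obtain ⟨h₃, h₂, h₁, h₀⟩ := cubic_eq_zero_of_double_roots (a := a) (b := b)
    (f₃ := Λ * (s - 1))
    (f₂ := -((Λ + 1) * (s * (a + b) - t)) - 2 * t + Λ * (v + c + d))
    (f₁ := (Λ + 1) * (a * b * s - (a + b) * t) + (a * b * s + (a + b) * t)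
      - Λ * (c * d + v * (c + d)))
    (f₀ := (Λ + 1) * (a * b) * t + Λ * (v * c * d)) hab
    (by linear_combination -hp) (by linear_combination hq)
    (by linear_combination hda) (by linear_combination hdb)
  have hs1 : s = 1 := by
    have := (mul_eq_zero.1 h₃).resolve_left hΛ
    linear_combination this
  subst hs1
  exact ⟨-t, by linear_combination -h₂, by linear_combination h₁, by linear_combination -h₀⟩

/-- A cubic polynomial has no pair of critical roots of zero weight. -/
theorem not_bethe_of_weight_eq_zero {a b v c d : ℂ} (hab : a ≠ b)
    (hav : a ≠ v) (hac : a ≠ c) (had : a ≠ d) (hbv : b ≠ v) (hbc : b ≠ c) (hbd : b ≠ d)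
    (ha : 1 / (a - v) + pairLog c d a - 2 / (a - b) = 0)
    (hb : 1 / (b - v) + pairLog c d b - 2 / (b - a) = 0) : False := by
  have hs := sub_ne_zero.2 hab
  have hs' := sub_ne_zero.2 hab.symm
  have h₁ := sub_ne_zero.2 hav
  have h₂ := sub_ne_zero.2 hac
  have h₃ := sub_ne_zero.2 had
  have h₄ := sub_ne_zero.2 hbv
  have h₅ := sub_ne_zero.2 hbc
  have h₆ := sub_ne_zero.2 hbd
  rw [pairLog] at ha hb
  field_simp at ha hb
  -- With f = (x - v)(x - c)(x - d) the equations read (a - b) f'(a) = 2 f(a) and (b - a) f'(b) = 2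
  -- f(b), while (a - b)(f'(a) + f'(b)) - 2 (f(a) - f(b)) = (a - b)³ for every monic cubic.
  have : (a - b) ^ 3 = 0 := by linear_combination ha - hb
  simp_all

end BetheAnsatz

end

noncomputable section

namespace BetheAnsatz


/-! ### Ratios -/

/-- Elimination of a color that has one root and one remaining neighbour v. The equation is linear
once x is known to be nonzero. -/
theorem leaf_iff {e x v : ℂ} (he : e + 1 ≠ 0) :
    (x ≠ v ∧ e / x + 1 / (x - v) = 0) ↔ e ≠ 0 ∧ v ≠ 0 ∧ x = ratio e * v := by
  rw [ratio]
  constructor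
  · rintro ⟨hxv, h⟩
    have hs := sub_ne_zero.2 hxv
    have hx : x ≠ 0 := by
      -- At x = 0 the term e / x has the value 0, which leaves 1 / (x - v) = 0.
      rintro rfl
      simp only [div_zero, zero_add] at h
      exact one_div_ne_zero hs h
    have he₀ : e ≠ 0 := by
      rintro rfl
      simp only [zero_div, zero_add] at h
      exact one_div_ne_zero hs h
    field_simp at h
    have hxe : x = e / (e + 1) * v := by
      field_simp
      linear_combination h
    refine ⟨he₀, ?_, hxe⟩
    rintro rfl
    simp [hx] at hxe
  · rintro ⟨he₀, hv, rfl⟩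
    have : e / (e + 1) * v - v = -v / (e + 1) := by field_simp; ring
    refine ⟨?_, ?_⟩
    · rw [← sub_ne_zero, this]
      exact div_ne_zero (neg_ne_zero.2 hv) he
    · rw [this]
      field_simp
      ring

/-- The action of an eliminated leaf on its neighbour v: a weight e + 1 at the origin. -/
theorem one_div_sub_ratio {e v : ℂ} (he : e + 1 ≠ 0) :
    1 / (v - ratio e * v) = (e + 1) / v := by
  by_cases hv : v = 0
  · simp [hv]
  have : v - e / (e + 1) * v = v / (e + 1) := by field_simp; ring
  rw [ratio, this]
  field_simp

theorem ratio_ne_zero {e : ℂ} (h : e ≠ 0) (he : e + 1 ≠ 0) : ratio e ≠ 0 := div_ne_zero h he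

theorem ratio_ne_one {e : ℂ} (he : e + 1 ≠ 0) : ratio e ≠ 1 := by
  rw [ratio, Ne, div_eq_one_iff_eq he]
  simp

theorem natCast_add_one_ne_zero (n : ℕ) : (n : ℂ) + 1 ≠ 0 := Nat.cast_add_one_ne_zero n

namespace Reproduction

variable {Λ a b u v c d M μ B : ℂ}

/-- The solution of the coefficient equations, if `c + d` and `c d` are known multiples of `u` and
`u²`. -/
theorem solve (h : Reproduction Λ a b u v c d) (hΛ : Λ ≠ 0) (hΛ₁ : Λ + 1 ≠ 0) (hM : M + 1 ≠ 0)
    (hμ : μ + 1 ≠ 0) (hΛμ : Λ + μ = M) (hB : B ≠ 1) (hu : u ≠ 0)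
    (hs : c + d = (M + (M + 2) * B) / (M + 1) * u) (hp : c * d = B * u ^ 2) :
    u = ratio μ * v ∧
      a + b = (M + (M + 2) * (ratio Λ * ratio μ * B)) / (M + 1) * v ∧
      a * b = ratio Λ * ratio μ * B * v ^ 2 := by
  subst hΛμ
  have hs' : (Λ + μ + 1) * (c + d) = (Λ + μ + (Λ + μ + 2) * B) * u := by
    rw [hs]; field_simp
  have hq : (Λ + 1) * (a * b) = Λ * B * u * v := by
    have : u * ((Λ + 1) * (a * b) - Λ * B * u * v) = 0 := by
      linear_combination h.coeff_zero + Λ * v * hp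
    exact sub_eq_zero.1 ((mul_eq_zero.1 this).resolve_left hu)
  -- Eliminating a + b and ab from the three coefficient equations leaves this relation times Λ u (1
  -- - B), which is why B ≠ 1 is needed.
  have huv : (μ + 1) * u = μ * v := by
    have : Λ * u * (1 - B) * ((μ + 1) * u - μ * v) = 0 := by
      linear_combination (Λ + μ + 1) * ((Λ + 1) * h.coeff_one - (Λ + 2) * hq
        - Λ * u * h.coeff_two + Λ * (Λ + 1) * hp) + (Λ * (Λ + 1) * v - Λ ^ 2 * u) * hs'
    have h1 : Λ * u * (1 - B) ≠ 0 := mul_ne_zero (mul_ne_zero hΛ hu) (sub_ne_zero.2 hB.symm)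
    exact sub_eq_zero.1 ((mul_eq_zero.1 this).resolve_left h1)
  have hu' : u = ratio μ * v := by
    rw [ratio]; field_simp; linear_combination huv
  refine ⟨hu', ?_, ?_⟩
  · have hc2 := h.coeff_two
    have : (Λ + 1) * (a + b) = Λ * (v + (c + d)) - (Λ - 1) * u := by linear_combination hc2
    rw [hs, hu'] at this
    have h2 : a + b = (Λ * (v + (Λ + μ + (Λ + μ + 2) * B) / (Λ + μ + 1) * (ratio μ * v))
      - (Λ - 1) * (ratio μ * v)) / (Λ + 1) := by
      rw [eq_div_iff hΛ₁]; linear_combination this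
    rw [h2, ratio, ratio]
    field_simp
    ring
  · have : a * b = Λ * B * u * v / (Λ + 1) := by
      rw [eq_div_iff hΛ₁]; linear_combination hq
    rw [this, hu', ratio, ratio]
    field_simp

/-- The converse of `solve`: a rational identity in Λ and μ, checked coefficient by coefficient. -/
theorem of_formulas (hΛ₁ : Λ + 1 ≠ 0) (hM : M + 1 ≠ 0)
    (hμ : μ + 1 ≠ 0) (hΛμ : Λ + μ = M) (hu : u = ratio μ * v)
    (hs : c + d = (M + (M + 2) * B) / (M + 1) * u) (hp : c * d = B * u ^ 2)
    (hs' : a + b = (M + (M + 2) * (ratio Λ * ratio μ * B)) / (M + 1) * v)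
    (hp' : a * b = ratio Λ * ratio μ * B * v ^ 2) : Reproduction Λ a b u v c d := by
  subst hΛμ
  refine ⟨?_, ?_, ?_⟩
  · rw [add_assoc v, hs, hs', hu, ratio, ratio]
    field_simp
    ring
  · rw [hp, hs, hs', hp', hu, ratio, ratio]
    field_simp
    ring
  · rw [mul_assoc v, hp, hp', hu, ratio, ratio]
    field_simp

/-- `y` and the right hand side have no common root. -/
theorem ne_of_root (h : Reproduction Λ a b u v c d) (ha : a ≠ 0) (hab : a ≠ b) (hua : u ≠ a) :
    a ≠ v ∧ a ≠ c ∧ a ≠ d := by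
  have key := h.identity a
  have hab' := sub_ne_zero.2 hab
  have hua' := sub_ne_zero.2 hua.symm
  have h₁ : Λ * ((a - v) * (a - c) * (a - d)) ≠ 0 := by
    rw [← key]
    have : a * ((a - b) * (a - u)) ≠ 0 := mul_ne_zero ha (mul_ne_zero hab' hua')
    contrapose! this
    linear_combination -this
  refine ⟨?_, ?_, ?_⟩ <;> rintro rfl <;> simp at h₁

/-- At x = u the identity becomes u y(u) = Λ (u - v)(u - c)(u - d), and the assumed shape of c, d
gives (u - c)(u - d) = u² (1 - B)/(M + 1). -/
theorem u_ne_root (h : Reproduction Λ a b u v c d) (hΛ : Λ ≠ 0) (hM : M + 1 ≠ 0) (hB : B ≠ 1)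
    (hu : u ≠ 0) (huv : u ≠ v)
    (hs : c + d = (M + (M + 2) * B) / (M + 1) * u) (hp : c * d = B * u ^ 2) :
    u ≠ a ∧ u ≠ b := by
  have key := h.identity u
  have hB' := sub_ne_zero.2 hB.symm
  have huv' := sub_ne_zero.2 huv
  have hcd : (u - c) * (u - d) = u ^ 2 * (1 - B) / (M + 1) := by
    have : (u - c) * (u - d) = u ^ 2 - (c + d) * u + c * d := by ring
    rw [this, hs, hp]
    field_simp
    ring
  have h₁ : u * ((u - a) * (u - b)) ≠ 0 := by
    have : u * ((u - a) * (u - b)) = Λ * (u - v) * (u ^ 2 * (1 - B) / (M + 1)) := by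
      rw [← hcd]; linear_combination key
    rw [this]
    positivity
  constructor <;> rintro rfl <;> simp at h₁

end Reproduction

/-- The discriminant factors: (M + 1)² (a - b)² = (M² - (M + 2)² G)(1 - G) v². -/
theorem ne_of_discriminant {a b v M G : ℂ} (hM : M + 1 ≠ 0) (hv : v ≠ 0) (hG : G ≠ 1)
    (hGM : M ^ 2 - (M + 2) ^ 2 * G ≠ 0)
    (hs : a + b = (M + (M + 2) * G) / (M + 1) * v) (hp : a * b = G * v ^ 2) : a ≠ b := by
  rintro rfl
  have hG' := sub_ne_zero.2 hG.symm
  have h₁ : (M + 1) ^ 2 * (a + a) ^ 2 = (M + (M + 2) * G) ^ 2 * v ^ 2 := by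
    rw [hs]; field_simp
  have h₂ : (M ^ 2 - (M + 2) ^ 2 * G) * (1 - G) * v ^ 2 = 0 := by
    linear_combination -h₁ + 4 * (M + 1) ^ 2 * hp
  simp_all

end BetheAnsatz

end

noncomputable section

namespace BetheAnsatz


/-! ### The part of the Bethe ansatz equation that involves pairs of variables -/

/-- The logarithmic derivative of the polynomial of the color preceding the color `j`; the color
preceding the color `0` has the single root `T`. -/
def incoming (T : ℂ) (a b : ℕ → ℂ) : ℕ → ℂ → ℂ
  | 0, x => 1 / (x - T)
  | j + 1, x => pairLog (a j) (b j) x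

/-- The Bethe ansatz equation for the colors `0, …, n - 1` with two variables `a j`, `b j` of
weight `w j`, and two further colors with single variables `a n`, `b n` of weights `e`, `f`. The
color `0` interacts with the single variable `T`. -/
structure TailSystem (n : ℕ) (w : ℕ → ℕ) (e f : ℕ) (T : ℂ) (a b : ℕ → ℂ) : Prop where
  ne_self : ∀ j < n, a j ≠ b j
  ne_start : a 0 ≠ T ∧ b 0 ≠ T
  ne_adj : ∀ j < n, a j ≠ a (j + 1) ∧ a j ≠ b (j + 1) ∧ b j ≠ a (j + 1) ∧ b j ≠ b (j + 1)
  ne_zero : ∀ j < n, w j ≠ 0 → a j ≠ 0 ∧ b j ≠ 0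
  ne_zero_last : (e ≠ 0 → a n ≠ 0) ∧ (f ≠ 0 → b n ≠ 0)
  eq_left : ∀ j < n, w j / a j + incoming T a b j (a j) + pairLog (a (j + 1)) (b (j + 1)) (a j)
    - 2 / (a j - b j) = 0
  eq_right : ∀ j < n, w j / b j + incoming T a b j (b j) + pairLog (a (j + 1)) (b (j + 1)) (b j)
    - 2 / (b j - a j) = 0
  eq_last : e / a n + incoming T a b n (a n) = 0 ∧ f / b n + incoming T a b n (b n) = 0

/-- The weight induced on the color `j` by the reproduction at the preceding colors. -/
def inducedWeight (w : ℕ → ℕ) (j : ℕ) : ℕ := ∑ i ∈ Finset.range j, w i + j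

@[simp] theorem inducedWeight_zero (w : ℕ → ℕ) : inducedWeight w 0 = 0 := by
  simp [inducedWeight]

theorem inducedWeight_succ (w : ℕ → ℕ) (j : ℕ) :
    inducedWeight w (j + 1) = w j + inducedWeight w j + 1 := by
  simp [inducedWeight, Finset.sum_range_succ]; ring

theorem monotone_inducedWeight (w : ℕ → ℕ) : Monotone (inducedWeight w) :=
  monotone_nat_of_le_succ fun j => by rw [inducedWeight_succ]; omega

/-- The total weight of the color `j`. -/
def totalWeight (w : ℕ → ℕ) (j : ℕ) : ℕ := w j + inducedWeight w j

/-- The weight at infinity. -/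
def tailWeight (n : ℕ) (w : ℕ → ℕ) (e f : ℕ) : ℕ := e + f + 2 * inducedWeight w n

/-- The weight dual to the total weight of the color `j`. -/
def dualWeight (n : ℕ) (w : ℕ → ℕ) (e f j : ℕ) : ℕ := tailWeight n w e f - totalWeight w j

/-- The solution of the linearized tail system. -/
def tailPoint (n : ℕ) (w : ℕ → ℕ) (e f : ℕ) (T : ℂ) (j : ℕ) : ℂ :=
  T * ∏ i ∈ Finset.range j, ratio (dualWeight n w e f i)

/-- The ratio of `a j * b j` and the square of `tailPoint n w e f T j`. -/
def tailProd (n : ℕ) (w : ℕ → ℕ) (e f j : ℕ) : ℂ :=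
  ratio (e + inducedWeight w n : ℕ) * ratio (f + inducedWeight w n : ℕ)
    * ∏ i ∈ Finset.Ico j n, (ratio (totalWeight w i) * ratio (dualWeight n w e f i))

/-- The ratio of `a j + b j` and `tailPoint n w e f T j`. -/
def tailSum (n : ℕ) (w : ℕ → ℕ) (e f j : ℕ) : ℂ :=
  (tailWeight n w e f + (tailWeight n w e f + 2) * tailProd n w e f j) / (tailWeight n w e f + 1)

/-! ### Positivity of the weights and bounds for the constants of the tail -/

section Weights

variable {n : ℕ} {w : ℕ → ℕ} {e f : ℕ}

/-- The induced weight is monotone and already equals `totalWeight w j + 1` at j + 1. Consequently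
the subtraction in `dualWeight` is not truncated. -/
theorem two_mul_totalWeight_add_two_le {j : ℕ} (hj : j < n) :
    2 * totalWeight w j + 2 ≤ tailWeight n w e f := by
  have h := monotone_inducedWeight w (Nat.succ_le_of_lt hj)
  rw [inducedWeight_succ] at h
  simp only [totalWeight, tailWeight]
  omega

theorem totalWeight_add_dualWeight {j : ℕ} (hj : j < n) :
    totalWeight w j + dualWeight n w e f j = tailWeight n w e f := by
  have := two_mul_totalWeight_add_two_le (w := w) (e := e) (f := f) hj
  simp only [dualWeight]
  omega

theorem totalWeight_ne_zero (hw : n ≠ 0 → w 0 ≠ 0) {j : ℕ} (hj : j < n) :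
    totalWeight w j ≠ 0 := by
  cases j with
  | zero => simpa [totalWeight] using hw (by omega)
  | succ j => simp [totalWeight, inducedWeight_succ]

theorem dualWeight_ne_zero {j : ℕ} (hj : j < n) : dualWeight n w e f j ≠ 0 := by
  have := two_mul_totalWeight_add_two_le (w := w) (e := e) (f := f) hj
  simp only [dualWeight]
  omega

@[simp] theorem tailPoint_zero (T : ℂ) : tailPoint n w e f T 0 = T := by simp [tailPoint]

theorem tailPoint_succ (T : ℂ) (j : ℕ) :
    tailPoint n w e f T (j + 1) = ratio (dualWeight n w e f j) * tailPoint n w e f T j := by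
  simp only [tailPoint, Finset.prod_range_succ]; ring

theorem tailPoint_ne_zero {T : ℂ} (hT : T ≠ 0) {j : ℕ} (hj : j ≤ n) :
    tailPoint n w e f T j ≠ 0 := by
  refine mul_ne_zero hT (Finset.prod_ne_zero_iff.2 fun i hi => ?_)
  exact ratio_ne_zero (Nat.cast_ne_zero.2 (dualWeight_ne_zero (by simp at hi; omega)))
    (natCast_add_one_ne_zero _)

theorem tailProd_self : tailProd n w e f n =
    ratio (e + inducedWeight w n : ℕ) * ratio (f + inducedWeight w n : ℕ) := by simp [tailProd]

theorem tailProd_of_lt {j : ℕ} (hj : j < n) : tailProd n w e f j =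
    ratio (totalWeight w j) * ratio (dualWeight n w e f j) * tailProd n w e f (j + 1) := by
  rw [tailProd, tailProd, ← Finset.insert_Ico_add_one_left_eq_Ico hj, Finset.prod_insert (by simp)]
  ring

/-- The two leaves already have the shape of a pair, because M is the sum of their weights. This
starts the induction back along the tail. -/
theorem tailSum_self : tailSum n w e f n =
    ratio (e + inducedWeight w n : ℕ) + ratio (f + inducedWeight w n : ℕ) := by
  have h₁ := natCast_add_one_ne_zero (e + inducedWeight w n)
  have h₂ := natCast_add_one_ne_zero (f + inducedWeight w n)
  have h₃ := natCast_add_one_ne_zero (tailWeight n w e f)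
  have h₄ : (tailWeight n w e f : ℂ)
      = ((e + inducedWeight w n : ℕ) : ℂ) + ((f + inducedWeight w n : ℕ) : ℂ) := by
    simp only [tailWeight]; push_cast; ring
  rw [h₄] at h₃
  rw [tailSum, tailProd_self, h₄, ratio, ratio]
  generalize ((e + inducedWeight w n : ℕ) : ℂ) = x at *
  generalize ((f + inducedWeight w n : ℕ) : ℂ) = y at *
  field_simp
  ring

/-- One inequality provides both G < 1 and the nonvanishing of M² - (M + 2)² G. At the fork it may
be an equality, namely for equal leaf weights; this is harmless, since the leaves have different
colors and may coincide. Each pair contributes two factors in (0, 1), which makes it strict. -/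
theorem exists_real_tailProd (hw : n ≠ 0 → w 0 ≠ 0) (he : e + inducedWeight w n ≠ 0)
    (hf : f + inducedWeight w n ≠ 0) {j : ℕ} (hj : j ≤ n) :
    ∃ g : ℝ, tailProd n w e f j = g ∧ 0 < g ∧
      g * (tailWeight n w e f + 2) ^ 2 ≤ tailWeight n w e f ^ 2 ∧
      (j < n → g * (tailWeight n w e f + 2) ^ 2 < tailWeight n w e f ^ 2) := by
  induction hj using Nat.decreasingInduction with
  | self =>
    have hM : tailWeight n w e f = (e + inducedWeight w n) + (f + inducedWeight w n) := by
      simp only [tailWeight]; ring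
    have he' : 0 < ((e + inducedWeight w n : ℕ) : ℝ) := by positivity
    have hf' : 0 < ((f + inducedWeight w n : ℕ) : ℝ) := by positivity
    rw [tailProd_self, hM]
    generalize e + inducedWeight w n = x at *
    generalize f + inducedWeight w n = y at *
    refine ⟨x / (x + 1) * (y / (y + 1)), by simp [ratio], by positivity, ?_, by simp⟩
    push_cast
    rw [div_mul_div_comm, div_mul_eq_mul_div, div_le_iff₀ (by positivity)]
    -- The difference of the two sides is (x + y + 1)(x - y)².
    nlinarith [mul_nonneg (add_pos he' hf').le (sq_nonneg ((x : ℝ) - y)),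
      sq_nonneg ((x : ℝ) - y)]
  | of_succ j hj ih =>
    obtain ⟨g, hg, hg₀, hg₁, -⟩ := ih
    have hx : 0 < (totalWeight w j : ℝ) :=
      Nat.cast_pos.2 (Nat.pos_of_ne_zero (totalWeight_ne_zero hw hj))
    have hy : 0 < (dualWeight n w e f j : ℝ) :=
      Nat.cast_pos.2 (Nat.pos_of_ne_zero (dualWeight_ne_zero hj))
    rw [tailProd_of_lt hj, hg]
    generalize totalWeight w j = x at *
    generalize dualWeight n w e f j = y at *
    have hr : (x / (x + 1) * (y / (y + 1)) : ℝ) < 1 :=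
      mul_lt_one_of_nonneg_of_lt_one_left (by positivity)
        ((div_lt_one (by positivity)).2 (by linarith))
        ((div_le_one (by positivity)).2 (by linarith))
    have hlt : x / (x + 1) * (y / (y + 1)) * g * ((tailWeight n w e f : ℝ) + 2) ^ 2
        < (tailWeight n w e f : ℝ) ^ 2 := by
      have h0 : 0 < g * ((tailWeight n w e f : ℝ) + 2) ^ 2 := by positivity
      calc _ = x / (x + 1) * (y / (y + 1)) * (g * ((tailWeight n w e f : ℝ) + 2) ^ 2) := by ring
        _ < 1 * (g * ((tailWeight n w e f : ℝ) + 2) ^ 2) := by gcongr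
        _ ≤ _ := by rwa [one_mul]
    exact ⟨x / (x + 1) * (y / (y + 1)) * g, by simp [ratio], by positivity, hlt.le, fun _ => hlt⟩

theorem tailProd_ne_zero (hw : n ≠ 0 → w 0 ≠ 0) (he : e + inducedWeight w n ≠ 0)
    (hf : f + inducedWeight w n ≠ 0) {j : ℕ} (hj : j ≤ n) : tailProd n w e f j ≠ 0 := by
  obtain ⟨g, hg, hg₀, -⟩ := exists_real_tailProd hw he hf hj
  rw [hg]
  exact_mod_cast hg₀.ne'

theorem tailProd_ne_one (hw : n ≠ 0 → w 0 ≠ 0) (he : e + inducedWeight w n ≠ 0)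
    (hf : f + inducedWeight w n ≠ 0) {j : ℕ} (hj : j ≤ n) : tailProd n w e f j ≠ 1 := by
  obtain ⟨g, hg, hg₀, hg₁, -⟩ := exists_real_tailProd hw he hf hj
  rw [hg]
  norm_cast
  rintro rfl
  have : (0 : ℝ) ≤ tailWeight n w e f := by positivity
  nlinarith

theorem discriminant_ne_zero (hw : n ≠ 0 → w 0 ≠ 0) (he : e + inducedWeight w n ≠ 0)
    (hf : f + inducedWeight w n ≠ 0) {j : ℕ} (hj : j < n) :
    (tailWeight n w e f : ℂ) ^ 2 - (tailWeight n w e f + 2) ^ 2 * tailProd n w e f j ≠ 0 := by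
  obtain ⟨g, hg, hg₀, -, hg₁⟩ := exists_real_tailProd hw he hf hj.le
  rw [hg]
  have := hg₁ hj
  norm_cast
  push_cast
  intro h
  linarith

end Weights

end BetheAnsatz

end

/-! ### Solution of the tail system by iterated reproduction -/

noncomputable section

namespace BetheAnsatz


/-- The explicit solution of the tail system. -/
structure TailSolution (n : ℕ) (w : ℕ → ℕ) (e f : ℕ) (T : ℂ) (a b : ℕ → ℂ) : Prop where
  ne_zero : T ≠ 0
  weight_ne_zero : n ≠ 0 → w 0 ≠ 0
  left_ne_zero : e + inducedWeight w n ≠ 0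
  right_ne_zero : f + inducedWeight w n ≠ 0
  sum : ∀ j < n, a j + b j = tailSum n w e f j * tailPoint n w e f T j
  prod : ∀ j < n, a j * b j = tailProd n w e f j * tailPoint n w e f T j ^ 2
  last_left : a n = ratio (e + inducedWeight w n : ℕ) * tailPoint n w e f T n
  last_right : b n = ratio (f + inducedWeight w n : ℕ) * tailPoint n w e f T n

variable {n : ℕ} {w : ℕ → ℕ} {e f : ℕ} {T : ℂ} {a b : ℕ → ℂ}

namespace TailSystem

/-- Multiply each equation by its variable and add from color j to the fork. The interactions become
integers by x/(x - y) + y/(y - x) = 1, so the only remaining unknown is the incoming sum. Its sign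
excludes roots at the origin below. -/
theorem sum_mul_incoming (h : TailSystem n w e f T a b) {j : ℕ} (hj : j ≤ n) :
    ∃ N : ℕ, a j * incoming T a b j (a j) + b j * incoming T a b j (b j) = -N := by
  induction hj using Nat.decreasingInduction with
  | self =>
    refine ⟨e + f, ?_⟩
    -- A root of weight zero may a priori be 0; then g / x vanishes by convention and the conclusion
    -- still holds.
    have aux : ∀ (g : ℕ) (x y : ℂ), (g ≠ 0 → x ≠ 0) → g / x + y = 0 → x * y = -g := by
      intro g x y hx hy
      by_cases hx₀ : x = 0
      · have : g = 0 := by by_contra hg; exact hx hg hx₀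
        simp [hx₀, this]
      · field_simp at hy
        linear_combination hy
    rw [aux e _ _ h.ne_zero_last.1 h.eq_last.1, aux f _ _ h.ne_zero_last.2 h.eq_last.2]
    push_cast
    ring
  | of_succ j hj ih =>
    obtain ⟨N, hN⟩ := ih
    refine ⟨2 * w j + 2 + N, ?_⟩
    have h₀ := sub_ne_zero.2 (h.ne_self j hj)
    have h₀' := sub_ne_zero.2 (h.ne_self j hj).symm
    obtain ⟨h₁, h₂, h₃, h₄⟩ := h.ne_adj j hj
    have h₁' := sub_ne_zero.2 h₁.symm
    have h₂' := sub_ne_zero.2 h₂.symm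
    have h₃' := sub_ne_zero.2 h₃.symm
    have h₄' := sub_ne_zero.2 h₄.symm
    replace h₁ := sub_ne_zero.2 h₁
    replace h₂ := sub_ne_zero.2 h₂
    replace h₃ := sub_ne_zero.2 h₃
    replace h₄ := sub_ne_zero.2 h₄
    have hz := h.ne_zero j hj
    have ea := h.eq_left j hj
    have eb := h.eq_right j hj
    have aux : ∀ x : ℂ, (w j ≠ 0 → x ≠ 0) → x * (w j / x) = w j := by
      intro x hx
      by_cases hx₀ : x = 0
      · have : w j = 0 := by by_contra hg; exact hx hg hx₀
        simp [this]
      · field_simp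
    have ha := aux (a j) fun hw => (hz hw).1
    have hb := aux (b j) fun hw => (hz hw).2
    have hp : ∀ x y : ℂ, x - y ≠ 0 → y - x ≠ 0 → x * (1 / (x - y)) = 1 - y * (1 / (y - x)) := by
      intro x y hxy hyx
      have : y - x = -(x - y) := by ring
      rw [this]
      field_simp
      ring
    have hs : a j * (2 / (a j - b j)) + b j * (2 / (b j - a j)) = 2 := by
      have : b j - a j = -(a j - b j) := by ring
      rw [this]
      field_simp
      ring
    simp only [incoming.eq_2, pairLog] at hN ea eb
    push_cast
    linear_combination a j * ea + b j * eb - ha - hb + hs + hN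
      - hp _ _ h₁ h₁' - hp _ _ h₂ h₂' - hp _ _ h₃ h₃' - hp _ _ h₄ h₄'

theorem start_ne_zero (h : TailSystem n w e f T a b) : T ≠ 0 := by
  rintro rfl
  -- For T = 0 each of the two incoming terms contributes 1, so 2 = -N.
  obtain ⟨N, hN⟩ := h.sum_mul_incoming (Nat.zero_le n)
  simp only [incoming, sub_zero] at hN
  rw [mul_one_div_cancel h.ne_start.1, mul_one_div_cancel h.ne_start.2] at hN
  have : ((2 + N : ℕ) : ℂ) = 0 := by push_cast; linear_combination hN
  norm_cast at this
  omega

theorem weight_ne_zero (h : TailSystem n w e f T a b) (hn : n ≠ 0) : w 0 ≠ 0 := by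
  intro hw
  have hn' : 0 < n := Nat.pos_of_ne_zero hn
  obtain ⟨h₁, h₂, h₃, h₄⟩ := h.ne_adj 0 hn'
  have ea := h.eq_left 0 hn'
  have eb := h.eq_right 0 hn'
  simp only [hw, Nat.cast_zero, zero_div, zero_add, incoming] at ea eb
  exact not_bethe_of_weight_eq_zero (h.ne_self 0 hn') h.ne_start.1 h₁ h₂ h.ne_start.2 h₃ h₄ ea eb

/-- If c = 0, then u = 0 and d ≠ 0, so the logarithmic derivative of y at d is (Λ + 2)/d. The sum in
the hypothesis would then be the positive number Λ + 2. -/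
theorem root_ne_zero {Λ N : ℕ} {a b u v c d : ℂ} (h : Reproduction Λ a b u v c d) (ha : a ≠ 0)
    (hb : b ≠ 0) (hd : d ≠ a ∧ d ≠ b) (hN : c * pairLog a b c + d * pairLog a b d = -N) :
    c ≠ 0 := by
  rintro rfl
  have hd₀ := h.second_ne_zero (natCast_add_one_ne_zero Λ) (by norm_cast) ha hb
  obtain ⟨-, ht⟩ := h.transfer (w := d) (by simp) hd₀ hd.1 hd.2
  have hu := h.u_eq_zero (natCast_add_one_ne_zero Λ) ha hb
  subst hu
  rw [ht, sub_zero, zero_mul, zero_add] at hN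
  field_simp at hN
  have : ((Λ + 2 + N : ℕ) : ℂ) = 0 := by push_cast; linear_combination hN
  norm_cast at this
  omega

/-- Pushes reproduction from color 0 to color j. The last two clauses are the invariant: after
replacing the preceding pairs by their partners, color j sees only a weight at the origin and the
single root `u j`. Its own pair then satisfies the hypotheses of `exists_reproduction`. -/
theorem exists_reproduction_chain (h : TailSystem n w e f T a b) (hn : n ≠ 0) {j : ℕ}
    (hj : j ≤ n) :
    ∃ u : ℕ → ℂ, u 0 = T ∧ (∀ i ≤ j, u i ≠ 0) ∧
      (∀ i < j, Reproduction (totalWeight w i : ℕ) (a i) (b i) (u (i + 1)) (u i) (a (i + 1))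
        (b (i + 1))) ∧
      a j ≠ 0 ∧ b j ≠ 0 ∧ a j ≠ u j ∧ b j ≠ u j ∧
      incoming T a b j (a j) = inducedWeight w j / a j + 1 / (a j - u j) ∧
      incoming T a b j (b j) = inducedWeight w j / b j + 1 / (b j - u j) := by
  induction j with
  | zero =>
    have hz := h.ne_zero 0 (by omega) (h.weight_ne_zero hn)
    refine ⟨fun _ => T, rfl, fun _ _ => h.start_ne_zero, by simp, hz.1, hz.2, h.ne_start.1,
      h.ne_start.2, ?_, ?_⟩ <;> simp [incoming]
  | succ j ih =>
    obtain ⟨u, hu₀, hu, hrep, ha, hb, hau, hbu, hia, hib⟩ := ih (by omega)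
    have hj' : j < n := hj
    have hΛ : (totalWeight w j : ℂ) ≠ 0 :=
      Nat.cast_ne_zero.2 (totalWeight_ne_zero h.weight_ne_zero hj')
    obtain ⟨h₁, h₂, h₃, h₄⟩ := h.ne_adj j hj'
    have ea := h.eq_left j hj'
    have eb := h.eq_right j hj'
    obtain ⟨v, hv⟩ := exists_reproduction hΛ ha hb (h.ne_self j hj') hau h₁ h₂ hbu h₃ h₄
      (by rw [← ea, hia]; simp only [totalWeight]; push_cast; ring)
      (by rw [← eb, hib]; simp only [totalWeight]; push_cast; ring)
    obtain ⟨N, hN⟩ := h.sum_mul_incoming hj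
    simp only [incoming] at hN
    have ha' : a (j + 1) ≠ 0 := root_ne_zero hv ha hb ⟨h₂.symm, h₄.symm⟩ hN
    have hb' : b (j + 1) ≠ 0 := root_ne_zero hv.swap ha hb ⟨h₁.symm, h₃.symm⟩
      (by rw [add_comm]; exact hN)
    have hv₀ : v ≠ 0 := hv.u_ne_zero hΛ (hu j le_rfl) ha' hb'
    obtain ⟨hta, hta'⟩ := hv.transfer (w := a (j + 1)) (by simp) ha' h₁.symm h₃.symm
    obtain ⟨htb, htb'⟩ := hv.transfer (w := b (j + 1)) (by simp) hb' h₂.symm h₄.symm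
    have hself : Function.update u (j + 1) v (j + 1) = v := by simp
    have hne : ∀ i ≤ j, Function.update u (j + 1) v i = u i := fun i hi =>
      Function.update_of_ne (by omega) _ _
    refine ⟨Function.update u (j + 1) v, ?_, ?_, ?_, ha', hb', ?_, ?_, ?_, ?_⟩
    · rw [hne 0 (by omega), hu₀]
    · intro i hi
      rcases Nat.le_succ_iff.1 hi with hi | rfl
      · rw [hne i hi]; exact hu i hi
      · rwa [hself]
    · intro i hi
      rw [hne i (by omega)]
      rcases Nat.lt_succ_iff_lt_or_eq.1 hi with hi | rfl
      · rw [hne (i + 1) (by omega)]; exact hrep i hi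
      · rwa [hself]
    · rwa [hself]
    · rwa [hself]
    · rw [hself, incoming, hta', inducedWeight_succ, totalWeight]; push_cast; ring
    · rw [hself, incoming, htb', inducedWeight_succ, totalWeight]; push_cast; ring

theorem solution (h : TailSystem n w e f T a b) : TailSolution n w e f T a b := by
  by_cases hn : n = 0
  · subst hn
    have h₁ := h.eq_last.1
    have h₂ := h.eq_last.2
    simp only [incoming] at h₁ h₂
    obtain ⟨he, hT, ha⟩ := (leaf_iff (natCast_add_one_ne_zero e)).1 ⟨h.ne_start.1, h₁⟩
    obtain ⟨hf, -, hb⟩ := (leaf_iff (natCast_add_one_ne_zero f)).1 ⟨h.ne_start.2, h₂⟩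
    exact ⟨hT, by simp, by simpa using he, by simpa using hf, by simp, by simp, by simpa using ha,
      by simpa using hb⟩
  have hw : n ≠ 0 → w 0 ≠ 0 := h.weight_ne_zero
  obtain ⟨u, hu₀, hu, hrep, ha, hb, hau, hbu, hia, hib⟩ := h.exists_reproduction_chain hn le_rfl
  have h₁ := h.eq_last.1
  have h₂ := h.eq_last.2
  rw [hia, ← add_assoc, ← add_div, ← Nat.cast_add] at h₁
  rw [hib, ← add_assoc, ← add_div, ← Nat.cast_add] at h₂
  obtain ⟨he, -, ha⟩ := (leaf_iff (natCast_add_one_ne_zero _)).1 ⟨hau, h₁⟩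
  obtain ⟨hf, -, hb⟩ := (leaf_iff (natCast_add_one_ne_zero _)).1 ⟨hbu, h₂⟩
  replace he := Nat.cast_ne_zero.1 he
  replace hf := Nat.cast_ne_zero.1 hf
  -- Back from the fork: the shape of the pair at j + 1 and the identity at j determine the shape at
  -- j and the quotient of u (j + 1) by u j.
  have key : ∀ j ≤ n, (a j + b j = tailSum n w e f j * u j ∧
      a j * b j = tailProd n w e f j * u j ^ 2) ∧
      (j < n → u (j + 1) = ratio (dualWeight n w e f j) * u j) := by
    intro j hj
    induction hj using Nat.decreasingInduction with
    | self =>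
      refine ⟨⟨?_, ?_⟩, by simp⟩
      · rw [tailSum_self, ha, hb]; ring
      · rw [tailProd_self, ha, hb]; ring
    | of_succ j hj ih =>
      obtain ⟨h₁, h₂, h₃⟩ := (hrep j hj).solve
        (Nat.cast_ne_zero.2 (totalWeight_ne_zero hw hj)) (natCast_add_one_ne_zero _)
        (natCast_add_one_ne_zero (tailWeight n w e f))
        (natCast_add_one_ne_zero (dualWeight n w e f j))
        (by rw [← Nat.cast_add, totalWeight_add_dualWeight hj])
        (tailProd_ne_one hw he hf (j := j + 1) hj) (hu (j + 1) hj) ih.1.1 ih.1.2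
      rw [← tailProd_of_lt hj] at h₂ h₃
      exact ⟨⟨h₂, h₃⟩, fun _ => h₁⟩
  -- The quotients are multiplied up from u 0 = T.
  have hpt : ∀ j ≤ n, u j = tailPoint n w e f T j := by
    intro j hj
    induction j with
    | zero => simpa using hu₀
    | succ j ih => rw [(key j (by omega)).2 (by omega), ih (by omega), tailPoint_succ]
  refine ⟨h.start_ne_zero, hw, he, hf, ?_, ?_, ?_, ?_⟩
  · intro j hj
    rw [(key j hj.le).1.1, hpt j hj.le]
  · intro j hj
    rw [(key j hj.le).1.2, hpt j hj.le]
  · rw [ha, hpt n le_rfl]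
  · rw [hb, hpt n le_rfl]

end TailSystem

namespace TailSolution

theorem sum_of_le (h : TailSolution n w e f T a b) {j : ℕ} (hj : j ≤ n) :
    a j + b j = tailSum n w e f j * tailPoint n w e f T j := by
  rcases hj.lt_or_eq with hj | rfl
  · exact h.sum j hj
  · rw [h.last_left, h.last_right, tailSum_self]; ring

theorem prod_of_le (h : TailSolution n w e f T a b) {j : ℕ} (hj : j ≤ n) :
    a j * b j = tailProd n w e f j * tailPoint n w e f T j ^ 2 := by
  rcases hj.lt_or_eq with hj | rfl
  · exact h.prod j hj
  · rw [h.last_left, h.last_right, tailProd_self]; ring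

theorem reproduction (h : TailSolution n w e f T a b) {j : ℕ} (hj : j < n) :
    Reproduction (totalWeight w j : ℕ) (a j) (b j) (tailPoint n w e f T (j + 1))
      (tailPoint n w e f T j) (a (j + 1)) (b (j + 1)) := by
  refine Reproduction.of_formulas (natCast_add_one_ne_zero _)
    (natCast_add_one_ne_zero (tailWeight n w e f))
    (natCast_add_one_ne_zero (dualWeight n w e f j))
    (by rw [← Nat.cast_add, totalWeight_add_dualWeight hj]) (tailPoint_succ T j)
    (h.sum_of_le hj) (h.prod_of_le hj) ?_ ?_
  · rw [← tailProd_of_lt hj]; exact h.sum j hj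
  · rw [← tailProd_of_lt hj]; exact h.prod j hj

theorem root_ne_zero (h : TailSolution n w e f T a b) {j : ℕ} (hj : j ≤ n) :
    a j ≠ 0 ∧ b j ≠ 0 := by
  rw [← mul_ne_zero_iff, h.prod_of_le hj]
  exact mul_ne_zero (tailProd_ne_zero h.weight_ne_zero h.left_ne_zero h.right_ne_zero hj)
    (pow_ne_zero _ (tailPoint_ne_zero h.ne_zero hj))

theorem ne_self (h : TailSolution n w e f T a b) {j : ℕ} (hj : j < n) : a j ≠ b j :=
  ne_of_discriminant (natCast_add_one_ne_zero (tailWeight n w e f))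
    (tailPoint_ne_zero h.ne_zero hj.le)
    (tailProd_ne_one h.weight_ne_zero h.left_ne_zero h.right_ne_zero hj.le)
    (discriminant_ne_zero h.weight_ne_zero h.left_ne_zero h.right_ne_zero hj)
    (h.sum j hj) (h.prod j hj)

/-- The partner root differs from both roots of the pair, so a common zero of y and the right hand
side of the reproduction identity is impossible. -/
theorem ne_adj (h : TailSolution n w e f T a b) {j : ℕ} (hj : j < n) :
    (a j ≠ tailPoint n w e f T j ∧ a j ≠ a (j + 1) ∧ a j ≠ b (j + 1)) ∧
    (b j ≠ tailPoint n w e f T j ∧ b j ≠ a (j + 1) ∧ b j ≠ b (j + 1)) := by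
  have hrep := h.reproduction hj
  have hv := tailPoint_ne_zero (w := w) (e := e) (f := f) h.ne_zero hj.le
  have huv : tailPoint n w e f T (j + 1) ≠ tailPoint n w e f T j := by
    rw [tailPoint_succ]
    intro hh
    exact ratio_ne_one (natCast_add_one_ne_zero (dualWeight n w e f j))
      (mul_right_cancel₀ hv (by rw [hh, one_mul]))
  obtain ⟨h₁, h₂⟩ := hrep.u_ne_root
    (Nat.cast_ne_zero.2 (totalWeight_ne_zero h.weight_ne_zero hj))
    (natCast_add_one_ne_zero (tailWeight n w e f))
    (tailProd_ne_one h.weight_ne_zero h.left_ne_zero h.right_ne_zero (j := j + 1) hj)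
    (tailPoint_ne_zero h.ne_zero hj) huv (h.sum_of_le hj) (h.prod_of_le hj)
  have hz := h.root_ne_zero hj.le
  exact ⟨hrep.ne_of_root hz.1 (h.ne_self hj) h₁, hrep.symm.ne_of_root hz.2 (h.ne_self hj).symm h₂⟩

theorem incoming_eq (h : TailSolution n w e f T a b) {j : ℕ} (hj : j ≤ n) :
    incoming T a b j (a j) = inducedWeight w j / a j + 1 / (a j - tailPoint n w e f T j) ∧
    incoming T a b j (b j) = inducedWeight w j / b j + 1 / (b j - tailPoint n w e f T j) := by
  cases j with
  | zero => simp [incoming]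
  | succ j =>
    have hrep := h.reproduction hj
    obtain ⟨⟨-, h₁, h₂⟩, -, h₃, h₄⟩ := h.ne_adj hj
    obtain ⟨ha, hb⟩ := h.root_ne_zero hj
    rw [incoming, incoming, (hrep.transfer (by simp) ha h₁.symm h₃.symm).2,
      (hrep.transfer (by simp) hb h₂.symm h₄.symm).2, inducedWeight_succ, totalWeight]
    push_cast
    exact ⟨rfl, rfl⟩

/-- The previous root T is itself a zero of the right hand side of the first reproduction identity.
There the pair acts as (Λ + 1)/T + 1/(T - u), and u = ratio μ * T turns the second term into (μ +
1)/T, where Λ + μ = M. -/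
theorem pairLog_start (h : TailSolution n w e f T a b) :
    pairLog (a 0) (b 0) T = (tailWeight n w e f + 2 : ℕ) / T := by
  rcases Nat.eq_zero_or_pos n with rfl | hn
  · rw [pairLog, h.last_left, h.last_right, tailPoint_zero,
      one_div_sub_ratio (natCast_add_one_ne_zero _), one_div_sub_ratio (natCast_add_one_ne_zero _)]
    simp only [tailWeight, inducedWeight_zero]
    push_cast
    ring
  · have hrep := h.reproduction hn
    obtain ⟨⟨h₁, -⟩, h₂, -⟩ := h.ne_adj hn
    rw [tailPoint_succ, tailPoint_zero] at hrep
    rw [tailPoint_zero] at h₁ h₂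
    rw [(hrep.transfer (by simp) h.ne_zero h₁.symm h₂.symm).2,
      one_div_sub_ratio (natCast_add_one_ne_zero _), ← totalWeight_add_dualWeight hn]
    push_cast
    ring

theorem system (h : TailSolution n w e f T a b) : TailSystem n w e f T a b := by
  have hΛ : ∀ j < n, (totalWeight w j : ℂ) ≠ 0 := fun j hj =>
    Nat.cast_ne_zero.2 (totalWeight_ne_zero h.weight_ne_zero hj)
  have hla := (leaf_iff (natCast_add_one_ne_zero _)).2
    ⟨Nat.cast_ne_zero.2 h.left_ne_zero, tailPoint_ne_zero h.ne_zero le_rfl, h.last_left⟩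
  have hlb := (leaf_iff (natCast_add_one_ne_zero _)).2
    ⟨Nat.cast_ne_zero.2 h.right_ne_zero, tailPoint_ne_zero h.ne_zero le_rfl, h.last_right⟩
  refine ⟨fun j => h.ne_self, ?_, ?_, fun j hj _ => h.root_ne_zero hj.le,
    ⟨fun _ => (h.root_ne_zero le_rfl).1, fun _ => (h.root_ne_zero le_rfl).2⟩, ?_, ?_, ?_, ?_⟩
  · rcases Nat.eq_zero_or_pos n with rfl | hn
    · exact ⟨by simpa only [tailPoint_zero] using hla.1, by simpa only [tailPoint_zero] using hlb.1⟩
    · obtain ⟨⟨h₁, -⟩, h₂, -⟩ := h.ne_adj hn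
      rw [tailPoint_zero] at h₁ h₂
      exact ⟨h₁, h₂⟩
  · intro j hj
    obtain ⟨⟨-, h₁⟩, -, h₂⟩ := h.ne_adj hj
    exact ⟨h₁.1, h₁.2, h₂⟩
  · intro j hj
    obtain ⟨⟨h₀, h₁, h₂⟩, -⟩ := h.ne_adj hj
    rw [← (h.reproduction hj).bethe (hΛ j hj) (h.root_ne_zero hj.le).1 (h.ne_self hj) h₀ h₁ h₂,
      (h.incoming_eq hj.le).1, totalWeight]
    push_cast
    ring
  · intro j hj
    obtain ⟨-, h₀, h₁, h₂⟩ := h.ne_adj hj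
    rw [← (h.reproduction hj).symm.bethe (hΛ j hj) (h.root_ne_zero hj.le).2 (h.ne_self hj).symm
      h₀ h₁ h₂, (h.incoming_eq hj.le).2, totalWeight]
    push_cast
    ring
  · rw [(h.incoming_eq le_rfl).1, ← add_assoc, ← add_div, ← Nat.cast_add]
    exact hla.2
  · rw [(h.incoming_eq le_rfl).2, ← add_assoc, ← add_div, ← Nat.cast_add]
    exact hlb.2

end TailSolution

theorem tailSystem_iff : TailSystem n w e f T a b ↔ TailSolution n w e f T a b :=
  ⟨TailSystem.solution, TailSolution.system⟩

end BetheAnsatz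

end

noncomputable section

namespace BetheAnsatz


/-! ### The part of the Bethe ansatz equation that involves single variables -/

/-- The Bethe ansatz equation for the colors `1, …, n` with single variables `s k` of weight
`lam k`, with a total interaction `W / s n` of the color `n` with the colors after it. -/
structure HeadSystem (n : ℕ) (lam : ℕ → ℕ) (W : ℕ) (s : ℕ → ℂ) : Prop where
  start : s 0 = 1
  ne_adj : ∀ k < n, s (k + 1) ≠ s k
  ne_zero : ∀ k < n, lam (k + 1) ≠ 0 → s (k + 1) ≠ 0
  eq : ∀ k, k + 1 < n →
    lam (k + 1) / s (k + 1) + 1 / (s (k + 1) - s k) + 1 / (s (k + 1) - s (k + 2)) = 0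
  eq_last : ∀ k, k + 1 = n → lam (k + 1) / s (k + 1) + 1 / (s (k + 1) - s k) + W / s (k + 1) = 0

/-- The total weight of the color `k`. -/
def headWeight (n : ℕ) (lam : ℕ → ℕ) (W k : ℕ) : ℕ := ∑ j ∈ Finset.Icc k n, lam j + W + (n - k)

theorem headWeight_self (n : ℕ) (lam : ℕ → ℕ) (W : ℕ) : headWeight n lam W n = lam n + W := by
  simp [headWeight]

theorem headWeight_of_lt {n : ℕ} (lam : ℕ → ℕ) (W : ℕ) {k : ℕ} (hk : k < n) :
    headWeight n lam W k = lam k + headWeight n lam W (k + 1) + 1 := by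
  rw [headWeight, headWeight, ← Finset.insert_Icc_add_one_left_eq_Icc hk.le,
    Finset.sum_insert (by simp)]
  omega

/-- The explicit solution of the head system. -/
structure HeadSolution (n : ℕ) (lam : ℕ → ℕ) (W : ℕ) (s : ℕ → ℂ) : Prop where
  weight_ne_zero : n ≠ 0 → lam n + W ≠ 0
  formula : ∀ k ≤ n, s k = ∏ i ∈ Finset.Icc 1 k, ratio (headWeight n lam W i)

variable {n : ℕ} {lam : ℕ → ℕ} {W : ℕ} {s : ℕ → ℂ}

theorem headWeight_ne_zero (hW : n ≠ 0 → lam n + W ≠ 0) {k : ℕ} (hk : k < n) :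
    headWeight n lam W (k + 1) ≠ 0 := by
  rcases (Nat.succ_le_of_lt hk).lt_or_eq with hk | rfl
  · rw [headWeight_of_lt _ _ hk]; omega
  · rw [headWeight_self]; exact hW (by omega)

/-- Color n is a leaf attached to color n - 1. Once color k + 1 is eliminated, it adds its total
weight plus 1 to color k, which becomes a leaf in turn. -/
theorem HeadSystem.solution (h : HeadSystem n lam W s) : HeadSolution n lam W s := by
  have key : ∀ k, k + 1 ≤ n → headWeight n lam W (k + 1) ≠ 0 ∧ s k ≠ 0 ∧
      s (k + 1) = ratio (headWeight n lam W (k + 1)) * s k := by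
    intro k hk
    have aux : headWeight n lam W (k + 1) / s (k + 1) + 1 / (s (k + 1) - s k) = 0 →
        headWeight n lam W (k + 1) ≠ 0 ∧ s k ≠ 0 ∧
          s (k + 1) = ratio (headWeight n lam W (k + 1)) * s k := by
      intro h₁
      have := (leaf_iff (natCast_add_one_ne_zero _)).1 ⟨h.ne_adj k hk, h₁⟩
      exact ⟨Nat.cast_ne_zero.1 this.1, this.2⟩
    obtain ⟨m, rfl⟩ : ∃ m, n = m + 1 := ⟨n - 1, by omega⟩
    have hkm : k ≤ m := by omega
    clear hk
    induction hkm using Nat.decreasingInduction with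
    | self =>
      refine aux ?_
      rw [← h.eq_last m rfl, headWeight_self]
      push_cast
      ring
    | of_succ k hk ih =>
      have ih' := ih fun h₁ => by
        have := (leaf_iff (natCast_add_one_ne_zero _)).1 ⟨h.ne_adj (k + 1) (by omega), h₁⟩
        exact ⟨Nat.cast_ne_zero.1 this.1, this.2⟩
      refine aux ?_
      have h₁ := h.eq k (by omega)
      rw [ih'.2.2, one_div_sub_ratio (natCast_add_one_ne_zero _)] at h₁
      rw [← h₁, headWeight_of_lt lam W (k := k + 1) (by omega)]
      push_cast
      ring
  refine ⟨fun hn => ?_, fun k hk => ?_⟩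
  · obtain ⟨m, rfl⟩ : ∃ m, n = m + 1 := ⟨n - 1, by omega⟩
    have := (key m le_rfl).1
    rwa [headWeight_self] at this
  · induction k with
    | zero => simpa using h.start
    | succ k ih => rw [(key k hk).2.2, ih (by omega), Finset.prod_Icc_succ_top (by omega), mul_comm]

namespace HeadSolution

theorem ne_zero (h : HeadSolution n lam W s) {k : ℕ} (hk : k ≤ n) : s k ≠ 0 := by
  rw [h.formula k hk]
  refine Finset.prod_ne_zero_iff.2 fun i hi => ?_
  rw [Finset.mem_Icc] at hi
  obtain ⟨j, rfl⟩ : ∃ j, i = j + 1 := ⟨i - 1, by omega⟩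
  exact ratio_ne_zero (Nat.cast_ne_zero.2 (headWeight_ne_zero h.weight_ne_zero (by omega)))
    (natCast_add_one_ne_zero _)

theorem succ (h : HeadSolution n lam W s) {k : ℕ} (hk : k < n) :
    s (k + 1) = ratio (headWeight n lam W (k + 1)) * s k := by
  rw [h.formula _ hk, h.formula k hk.le, Finset.prod_Icc_succ_top (by omega), mul_comm]

theorem system (h : HeadSolution n lam W s) : HeadSystem n lam W s := by
  have key : ∀ k < n, s (k + 1) ≠ s k ∧
      headWeight n lam W (k + 1) / s (k + 1) + 1 / (s (k + 1) - s k) = 0 := fun k hk =>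
    (leaf_iff (natCast_add_one_ne_zero _)).2
      ⟨Nat.cast_ne_zero.2 (headWeight_ne_zero h.weight_ne_zero hk), h.ne_zero hk.le, h.succ hk⟩
  refine ⟨by simpa using h.formula 0 (by omega), fun k hk => (key k hk).1,
    fun k hk _ => h.ne_zero hk, fun k hk => ?_, fun k hk => ?_⟩
  · rw [h.succ hk, one_div_sub_ratio (natCast_add_one_ne_zero _), ← (key k (by omega)).2,
      headWeight_of_lt lam W hk]
    push_cast
    ring
  · rw [← (key k (by omega)).2, hk, headWeight_self]
    push_cast
    ring

end HeadSolution

theorem headSystem_iff : HeadSystem n lam W s ↔ HeadSolution n lam W s :=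
  ⟨HeadSystem.solution, HeadSolution.system⟩

end BetheAnsatz

end

noncomputable section

namespace BetheAnsatz


/-! ### The Bethe ansatz equation in terms of colors -/

/-- The logarithmic derivative of the polynomial with the roots `τ 0, …, τ (l - 1)`. -/
def logDer (l : ℕ) (τ : ℕ → ℂ) (x : ℂ) : ℂ := ∑ a ∈ Finset.range l, 1 / (x - τ a)

/-- The logarithmic derivative of the product of the polynomials of the colors following the color
`k ≤ R` in the Dynkin diagram. -/
def outgoing (R : ℕ) (l : ℕ → ℕ) (τ : ℕ → ℕ → ℂ) (k : ℕ) (x : ℂ) : ℂ :=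
  if k < R then logDer (l (k + 1)) (τ (k + 1)) x
  else logDer (l (R + 1)) (τ (R + 1)) x + logDer (l (R + 2)) (τ (R + 2)) x

/-- The Bethe ansatz equation of type `D (R + 2)`. The variables of color `k`, `1 ≤ k ≤ R + 2`, are
`τ k a` for `a < l k`; the point `1` of weight `ω₁` is the single variable of color `0`. -/
structure ColorSystem (R : ℕ) (lam : ℕ → ℕ) (l : ℕ → ℕ) (τ : ℕ → ℕ → ℂ) : Prop where
  ne_zero : ∀ k < R + 2, ∀ a < l (k + 1), lam (k + 1) ≠ 0 → τ (k + 1) a ≠ 0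
  ne_self : ∀ k < R + 2, ∀ a < l (k + 1), ∀ b < l (k + 1), a ≠ b → τ (k + 1) a ≠ τ (k + 1) b
  ne_adj : ∀ k < R, ∀ a < l (k + 1), ∀ b < l k, τ (k + 1) a ≠ τ k b
  ne_fork : ∀ a < l R, (∀ b < l (R + 1), τ R a ≠ τ (R + 1) b) ∧ ∀ b < l (R + 2), τ R a ≠ τ (R + 2) b
  eq : ∀ k < R, ∀ a < l (k + 1), lam (k + 1) / τ (k + 1) a
    + logDer (l k) (τ k) (τ (k + 1) a) + outgoing R l τ (k + 1) (τ (k + 1) a)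
    - 2 * logDer (l (k + 1)) (τ (k + 1)) (τ (k + 1) a) = 0
  eq_end : ∀ k, k = R + 1 ∨ k = R + 2 → ∀ a < l k, lam k / τ k a + logDer (l R) (τ R) (τ k a)
    - 2 * logDer (l k) (τ k) (τ k a) = 0

/-- The weight ω₁ makes the point 1 an ordinary neighbour of the first color, with value ψ 0. The
function ψ is arbitrary because two cases are needed: logarithmic derivatives for the equations and
multiplicities for dominance. -/
theorem sum_cartanMatrix_D {R : ℕ} (hR : 2 ≤ R) (i : Fin (R + 2)) (ψ : ℕ → ℂ) :
    omegaOne (R + 2) i * ψ 0 - ∑ j : Fin (R + 2), (CartanMatrix.D (R + 2) i j : ℂ) * ψ (j + 1) =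
      if i.val + 1 < R then ψ i + ψ (i + 2) - 2 * ψ (i + 1)
      else if i.val + 1 = R then ψ i + (ψ (R + 1) + ψ (R + 2)) - 2 * ψ (i + 1)
      else ψ R - 2 * ψ (i + 1) := by
  have h₁ : ∀ c : ℕ, (∑ j : Fin (R + 2), if j.val = c then ψ (j + 1) else 0)
      = if c < R + 2 then ψ (c + 1) else 0 := by
    intro c
    rw [Fin.sum_univ_eq_sum_range (fun j => if j = c then ψ (j + 1) else 0),
      Finset.sum_ite_eq']
    simp
  have h₂ : ∀ c : ℕ, (∑ j : Fin (R + 2), if j.val + 1 = c then ψ (j + 1) else 0)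
      = if c = 0 then 0 else if c < R + 3 then ψ c else 0 := by
    intro c
    cases c with
    | zero => simp
    | succ c => simpa using h₁ c
  have hi := i.isLt
  split_ifs with hc hc'
  · have : ∀ j : Fin (R + 2), (CartanMatrix.D (R + 2) i j : ℂ) * ψ (j + 1)
        = 2 * (if j.val = i.val then ψ (j + 1) else 0)
          - (if j.val = i.val + 1 then ψ (j + 1) else 0)
          - (if j.val + 1 = i.val then ψ (j + 1) else 0) := by
      intro j
      have hj := j.isLt
      simp only [CartanMatrix.D, Matrix.of_apply, Fin.ext_iff]
      split_ifs <;> first | omega | (push_cast; ring)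
    simp only [this, Finset.sum_sub_distrib, ← Finset.mul_sum, h₁, h₂, omegaOne]
    by_cases h0 : i.val = 0
    · simp [h0]; ring
    · simp [h0, show i.val < R + 3 by omega, show i.val + 1 < R + 2 by omega, hi]; ring
  · have : ∀ j : Fin (R + 2), (CartanMatrix.D (R + 2) i j : ℂ) * ψ (j + 1)
        = 2 * (if j.val = i.val then ψ (j + 1) else 0)
          - (if j.val = R then ψ (j + 1) else 0) - (if j.val = R + 1 then ψ (j + 1) else 0)
          - (if j.val + 1 = i.val then ψ (j + 1) else 0) := by
      intro j
      have hj := j.isLt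
      simp only [CartanMatrix.D, Matrix.of_apply, Fin.ext_iff]
      split_ifs <;> first | omega | (push_cast; ring)
    simp only [this, Finset.sum_sub_distrib, ← Finset.mul_sum, h₁, h₂, omegaOne]
    have h0 : i.val ≠ 0 := by omega
    simp [h0, show i.val < R + 3 by omega, hi]; ring
  · have : ∀ j : Fin (R + 2), (CartanMatrix.D (R + 2) i j : ℂ) * ψ (j + 1)
        = 2 * (if j.val = i.val then ψ (j + 1) else 0)
          - (if j.val + 1 = R then ψ (j + 1) else 0) := by
      intro j
      have hj := j.isLt
      simp only [CartanMatrix.D, Matrix.of_apply, Fin.ext_iff]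
      split_ifs <;> first | omega | (push_cast; ring)
    simp only [this, Finset.sum_sub_distrib, ← Finset.mul_sum, h₁, h₂, omegaOne]
    have h0 : i.val ≠ 0 := by omega
    simp [h0, show R ≠ 0 by omega]

theorem bethe_sum_eq {R : ℕ} {wt : Weight (R + 2)} {l : Fin (R + 2) → ℕ}
    {t : Var l → ℂ} {m : ℕ → ℕ} {τ : ℕ → ℕ → ℂ} (hm₀ : m 0 = 1) (hτ₀ : τ 0 0 = 1)
    (hm : ∀ i, l i = m (i + 1)) (hτ : ∀ i (a : Fin (l i)), t ⟨i, a⟩ = τ (i + 1) a)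
    (p : Var l) :
    -(∑ s : Fin 2, rootForm (fun _ => 1) p.1 ((![wt, omegaOne (R + 2)] : Fin 2 → _) s)
          / (t p - (![0, 1] : Fin 2 → ℂ) s))
      + ∑ q ∈ Finset.univ.erase p,
        rootForm (fun _ => 1) p.1 (simpleRoot (CartanMatrix.D (R + 2)) q.1) / (t p - t q)
    = -(wt p.1 / t p + (omegaOne (R + 2) p.1 * logDer (m 0) (τ 0) (t p)
      - ∑ j : Fin (R + 2), (CartanMatrix.D (R + 2) p.1 j : ℂ)
        * logDer (m (j + 1)) (τ (j + 1)) (t p))) := by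
  -- The omitted term q = p has denominator 0, hence value 0, and can be restored; `logDer` at one
  -- of its own roots likewise counts only the other roots.
  rw [Finset.sum_erase _ (by simp), Fintype.sum_sigma]
  have : ∀ j : Fin (R + 2), ∑ b : Fin (l j), rootForm (fun _ => 1) p.1
      (simpleRoot (CartanMatrix.D (R + 2)) j) / (t p - t ⟨j, b⟩)
      = (CartanMatrix.D (R + 2) p.1 j : ℂ) * logDer (m (j + 1)) (τ (j + 1)) (t p) := by
    intro j
    rw [logDer, ← hm, ← Fin.sum_univ_eq_sum_range (fun b => 1 / (t p - τ (j + 1) b)),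
      Finset.mul_sum]
    refine Finset.sum_congr rfl fun b _ => ?_
    rw [hτ j b]
    simp [rootForm, simpleRoot, div_eq_mul_inv]
  simp only [this]
  simp [rootForm, logDer, hm₀, hτ₀]
  ring

theorem cartanMatrix_D_ne_zero_iff {R : ℕ} (hR : 2 ≤ R) (i j : Fin (R + 2)) :
    CartanMatrix.D (R + 2) i j ≠ 0 ↔ i.val = j.val ∨ (i.val + 1 = j.val ∧ j.val < R) ∨
      (j.val + 1 = i.val ∧ i.val < R) ∨ (i.val + 1 = R ∧ R ≤ j.val) ∨
      (j.val + 1 = R ∧ R ≤ i.val) := by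
  have hi := i.isLt
  have hj := j.isLt
  simp only [CartanMatrix.D, Matrix.of_apply, Fin.ext_iff]
  split_ifs <;> simp <;> omega

theorem isSolutionD_iff {R : ℕ} (hR : 2 ≤ R) {wt : Weight (R + 2)} {lam : ℕ → ℕ}
    (hlam : ∀ i, wt i = lam (i + 1)) {l : Fin (R + 2) → ℕ}
    {t : Var l → ℂ} {m : ℕ → ℕ} {τ : ℕ → ℕ → ℂ} (hm₀ : m 0 = 1) (hτ₀ : τ 0 0 = 1)
    (hm : ∀ i, l i = m (i + 1)) (hτ : ∀ i (a : Fin (l i)), t ⟨i, a⟩ = τ (i + 1) a) :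
    IsSolutionD wt l t ↔ ColorSystem R lam m τ := by
  have hvar : ∀ P : ℕ → ℕ → Prop, (∀ p : Var l, P p.1 p.2) ↔
      ∀ k < R + 2, ∀ a < m (k + 1), P k a := by
    intro P
    constructor
    · intro h k hk a ha
      exact h ⟨⟨k, hk⟩, ⟨a, by rw [hm]; exact ha⟩⟩
    · intro h p
      exact h _ p.1.isLt _ (by rw [← hm]; exact p.2.isLt)
  have ht : ∀ p : Var l, t p = τ (p.1 + 1) p.2 := fun p => hτ p.1 p.2
  have h₁ : (∀ (p : Var l) (s : Fin 2), rootForm (fun _ => 1) p.1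
      ((![wt, omegaOne (R + 2)] : Fin 2 → _) s) ≠ 0 → t p ≠ (![0, 1] : Fin 2 → ℂ) s) ↔
      ∀ k < R + 2, ∀ a < m (k + 1), (lam (k + 1) ≠ 0 → τ (k + 1) a ≠ 0) ∧
        (k = 0 → τ (k + 1) a ≠ 1) := by
    rw [← hvar fun k a => (lam (k + 1) ≠ 0 → τ (k + 1) a ≠ 0) ∧ (k = 0 → τ (k + 1) a ≠ 1)]
    refine forall_congr' fun p => ?_
    simp [Fin.forall_fin_two, rootForm, hlam, ht, omegaOne]
  have h₂ : (∀ p q : Var l, p ≠ q →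
      rootForm (fun _ => 1) p.1 (simpleRoot (CartanMatrix.D (R + 2)) q.1) ≠ 0 → t p ≠ t q) ↔
      ∀ k < R + 2, ∀ a < m (k + 1), ∀ j < R + 2, ∀ b < m (j + 1),
        (k = j → a ≠ b) → (k = j ∨ (k + 1 = j ∧ j < R) ∨ (j + 1 = k ∧ k < R) ∨
          (k + 1 = R ∧ R ≤ j) ∨ (j + 1 = R ∧ R ≤ k)) → τ (k + 1) a ≠ τ (j + 1) b := by
    rw [← hvar fun k a => ∀ j < R + 2, ∀ b < m (j + 1),
        (k = j → a ≠ b) → (k = j ∨ (k + 1 = j ∧ j < R) ∨ (j + 1 = k ∧ k < R) ∨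
          (k + 1 = R ∧ R ≤ j) ∨ (j + 1 = R ∧ R ≤ k)) → τ (k + 1) a ≠ τ (j + 1) b]
    refine forall_congr' fun p => ?_
    rw [← hvar fun j b => (p.1.val = j → p.2.val ≠ b) → (p.1.val = j ∨ (p.1.val + 1 = j ∧ j < R) ∨
      (j + 1 = p.1.val ∧ p.1.val < R) ∨ (p.1.val + 1 = R ∧ R ≤ j) ∨ (j + 1 = R ∧ R ≤ p.1.val)) →
        τ (p.1 + 1) p.2 ≠ τ (j + 1) b]
    refine forall_congr' fun q => ?_
    have hpq : p ≠ q ↔ (p.1.val = q.1.val → p.2.val ≠ q.2.val) := by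
      obtain ⟨i, a⟩ := p
      obtain ⟨j, b⟩ := q
      by_cases hij : i = j
      · subst hij
        simp [Fin.ext_iff]
      · simp [hij, ← Fin.ext_iff]
    have hA : rootForm (fun _ => 1) p.1 (simpleRoot (CartanMatrix.D (R + 2)) q.1) ≠ 0 ↔
        CartanMatrix.D (R + 2) p.1 q.1 ≠ 0 := by
      simp [rootForm, simpleRoot]
    rw [hpq, hA, cartanMatrix_D_ne_zero_iff hR, ht, ht]
  have h₃ : (∀ p : Var l,
      -(∑ s : Fin 2, rootForm (fun _ => 1) p.1 ((![wt, omegaOne (R + 2)] : Fin 2 → _) s)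
          / (t p - (![0, 1] : Fin 2 → ℂ) s))
      + ∑ q ∈ Finset.univ.erase p,
        rootForm (fun _ => 1) p.1 (simpleRoot (CartanMatrix.D (R + 2)) q.1) / (t p - t q) = 0) ↔
      ∀ k < R + 2, ∀ a < m (k + 1), lam (k + 1) / τ (k + 1) a +
        (if k + 1 < R then logDer (m k) (τ k) (τ (k + 1) a)
            + logDer (m (k + 2)) (τ (k + 2)) (τ (k + 1) a)
            - 2 * logDer (m (k + 1)) (τ (k + 1)) (τ (k + 1) a)
          else if k + 1 = R then logDer (m k) (τ k) (τ (k + 1) a)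
            + (logDer (m (R + 1)) (τ (R + 1)) (τ (k + 1) a)
              + logDer (m (R + 2)) (τ (R + 2)) (τ (k + 1) a))
            - 2 * logDer (m (k + 1)) (τ (k + 1)) (τ (k + 1) a)
          else logDer (m R) (τ R) (τ (k + 1) a)
            - 2 * logDer (m (k + 1)) (τ (k + 1)) (τ (k + 1) a)) = 0 := by
    rw [← hvar fun k a => lam (k + 1) / τ (k + 1) a +
        (if k + 1 < R then logDer (m k) (τ k) (τ (k + 1) a)
            + logDer (m (k + 2)) (τ (k + 2)) (τ (k + 1) a)
            - 2 * logDer (m (k + 1)) (τ (k + 1)) (τ (k + 1) a)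
          else if k + 1 = R then logDer (m k) (τ k) (τ (k + 1) a)
            + (logDer (m (R + 1)) (τ (R + 1)) (τ (k + 1) a)
              + logDer (m (R + 2)) (τ (R + 2)) (τ (k + 1) a))
            - 2 * logDer (m (k + 1)) (τ (k + 1)) (τ (k + 1) a)
          else logDer (m R) (τ R) (τ (k + 1) a)
            - 2 * logDer (m (k + 1)) (τ (k + 1)) (τ (k + 1) a)) = 0]
    refine forall_congr' fun p => ?_
    rw [bethe_sum_eq hm₀ hτ₀ hm hτ p, neg_eq_zero, hlam,
      sum_cartanMatrix_D hR p.1 fun k => logDer (m k) (τ k) (t p), ht]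
  rw [IsSolutionD, IsCriticalPoint, h₁, h₂, h₃]
  constructor
  · rintro ⟨g₁, g₂, g₃⟩
    refine ⟨fun k hk a ha => (g₁ k hk a ha).1, ?_, ?_, ?_, ?_, ?_⟩
    · intro k hk a ha b hb hab
      exact g₂ k hk a ha k hk b hb (fun _ => hab) (Or.inl rfl)
    · intro k hk a ha b hb
      cases k with
      | zero =>
        rw [hm₀, Nat.lt_one_iff] at hb
        subst hb
        rw [hτ₀]
        exact (g₁ 0 (by omega) a ha).2 rfl
      | succ k => exact g₂ (k + 1) (by omega) a ha k (by omega) b hb (by omega) (by omega)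
    · obtain ⟨k, rfl⟩ : ∃ k, R = k + 1 := ⟨R - 1, by omega⟩
      intro a ha
      exact ⟨fun b hb => g₂ k (by omega) a ha (k + 1) (by omega) b hb (by omega) (by omega),
        fun b hb => g₂ k (by omega) a ha (k + 2) (by omega) b hb (by omega) (by omega)⟩
    · intro k hk a ha
      have := g₃ k (by omega) a ha
      rw [outgoing]
      by_cases h : k + 1 < R
      · rw [if_pos h] at this ⊢
        linear_combination this
      · rw [if_neg h, if_pos (show k + 1 = R by omega)] at this
        rw [if_neg h]
        linear_combination this
    · intro k hk a ha
      obtain ⟨k, rfl⟩ : ∃ j, k = j + 1 := ⟨k - 1, by omega⟩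
      have := g₃ k (by omega) a ha
      rw [if_neg (by omega), if_neg (by omega)] at this
      linear_combination this
  · intro g
    refine ⟨fun k hk a ha => ⟨g.ne_zero k hk a ha, ?_⟩, ?_, ?_⟩
    · rintro rfl
      rw [← hτ₀]
      exact g.ne_adj 0 (by omega) a ha 0 (by omega)
    · intro k hk a ha j hj b hb hab hkj
      rcases hkj with rfl | ⟨rfl, h⟩ | ⟨rfl, h⟩ | ⟨rfl, h⟩ | ⟨rfl, h⟩
      · exact g.ne_self k hk a ha b hb (hab rfl)
      · exact (g.ne_adj _ h b hb a ha).symm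
      · exact g.ne_adj _ h a ha b hb
      · obtain rfl | rfl : j = k + 1 ∨ j = k + 2 := by omega
        · exact (g.ne_fork a ha).1 b hb
        · exact (g.ne_fork a ha).2 b hb
      · obtain rfl | rfl : k = j + 1 ∨ k = j + 2 := by omega
        · exact ((g.ne_fork b hb).1 a ha).symm
        · exact ((g.ne_fork b hb).2 a ha).symm
    · intro k hk a ha
      split_ifs with hc hc'
      · have := g.eq k (by omega) a ha
        rw [outgoing, if_pos hc] at this
        linear_combination this
      · have := g.eq k (by omega) a ha
        rw [outgoing, if_neg hc] at this
        linear_combination this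
      · linear_combination g.eq_end (k + 1) (by omega) a ha

end BetheAnsatz

end

/-! ### Reduction of the Bethe equations to head and tail systems -/

noncomputable section

namespace BetheAnsatz


theorem logDer_zero (τ : ℕ → ℂ) (x : ℂ) : logDer 0 τ x = 0 := by simp [logDer]

theorem logDer_one (τ : ℕ → ℂ) (x : ℂ) : logDer 1 τ x = 1 / (x - τ 0) := by simp [logDer]

theorem logDer_two (τ : ℕ → ℂ) (x : ℂ) : logDer 2 τ x = pairLog (τ 0) (τ 1) x := by
  simp [logDer, Finset.sum_range_succ, pairLog]

variable {R n : ℕ} {lam : ℕ → ℕ} {m : ℕ → ℕ} {τ : ℕ → ℕ → ℂ}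

/-- No variables follow color n, so the additional weight of the head is 0. -/
theorem colorSystem_iff_head (hn : n ≤ R) (hτ : τ 0 0 = 1) (hm₁ : ∀ k ≤ n, m k = 1)
    (hm₀ : ∀ k, n < k → m k = 0) :
    ColorSystem R lam m τ ↔ HeadSystem n lam 0 (fun k => τ k 0) := by
  have hlt : ∀ {k a : ℕ}, a < m k → k ≤ n ∧ a = 0 := by
    intro k a ha
    by_cases hk : k ≤ n
    · rw [hm₁ k hk] at ha; omega
    · rw [hm₀ k (by omega)] at ha; omega
  have h0 : ∀ {k : ℕ}, k ≤ n → 0 < m k := fun hk => by simp [hm₁ _ hk]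
  have hlog : ∀ k ≤ n, ∀ x, logDer (m k) (τ k) x = 1 / (x - τ k 0) := fun k hk x => by
    rw [hm₁ k hk, logDer_one]
  have hout : ∀ k < n, ∀ x, outgoing R m τ k x = 1 / (x - τ (k + 1) 0) := fun k hk x => by
    rw [outgoing, if_pos (by omega), hlog _ hk]
  have hout' : ∀ x, outgoing R m τ n x = 0 := fun x => by
    rw [outgoing]
    split_ifs
    · rw [hm₀ _ (by omega), logDer_zero]
    · rw [hm₀ _ (by omega), hm₀ _ (by omega), logDer_zero, logDer_zero, add_zero]
  constructor
  · intro h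
    refine ⟨hτ, fun k hk => h.ne_adj k (by omega) 0 (h0 hk) 0 (h0 hk.le),
      fun k hk => h.ne_zero k (by omega) 0 (h0 hk), fun k hk => ?_, ?_⟩
    · have := h.eq k (by omega) 0 (h0 (by omega))
      rw [hlog k (by omega), hlog (k + 1) (by omega), hout (k + 1) (by omega)] at this
      simpa using this
    · rintro k rfl
      have := h.eq k (by omega) 0 (h0 le_rfl)
      rw [hlog k (by omega), hlog (k + 1) (by omega), hout'] at this
      simpa using this
  · intro h
    refine ⟨?_, ?_, ?_, ?_, ?_, ?_⟩
    · intro k _ a ha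
      obtain ⟨hk, rfl⟩ := hlt ha
      exact h.ne_zero k hk
    · intro k _ a ha b hb
      have := (hlt ha).2
      have := (hlt hb).2
      omega
    · intro k _ a ha b hb
      obtain ⟨hk, rfl⟩ := hlt ha
      obtain ⟨-, rfl⟩ := hlt hb
      exact h.ne_adj k hk
    · intro a _
      constructor <;> intro b hb <;> have := (hlt hb).1 <;> omega
    · intro k _ a ha
      obtain ⟨hk, rfl⟩ := hlt ha
      rw [hlog k (by omega), hlog (k + 1) (by omega)]
      rcases hk.lt_or_eq with hk | rfl
      · rw [hout _ hk]
        simpa using h.eq k hk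
      · rw [hout']
        simpa using h.eq_last k rfl
    · intro k hk a ha
      have := (hlt ha).1
      omega

/-- One branch of the fork is occupied. Its root is a leaf attached to color R and is eliminated
first, which gives color R the additional weight `lam c + 1`. -/
theorem colorSystem_iff_leaf {c : ℕ} (hc : c = R + 1 ∨ c = R + 2) (hτ : τ 0 0 = 1)
    (hm₁ : ∀ k ≤ R, m k = 1) (hmc : m c = 1) (hm₀ : ∀ k, R < k → k ≠ c → m k = 0) :
    ColorSystem R lam m τ ↔ HeadSystem R lam (lam c + 1) (fun k => τ k 0) ∧
      lam c ≠ 0 ∧ τ c 0 = ratio (lam c) * τ R 0 := by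
  have hlt : ∀ {k a : ℕ}, a < m k → (k ≤ R ∨ k = c) ∧ a = 0 := by
    intro k a ha
    by_cases hk : k ≤ R
    · rw [hm₁ k hk] at ha; omega
    · by_cases hkc : k = c
      · rw [hkc, hmc] at ha; omega
      · rw [hm₀ k (by omega) hkc] at ha; omega
  have h0 : ∀ {k : ℕ}, k ≤ R → 0 < m k := fun hk => by simp [hm₁ _ hk]
  have h0c : 0 < m c := by simp [hmc]
  have hlog : ∀ k ≤ R, ∀ x, logDer (m k) (τ k) x = 1 / (x - τ k 0) := fun k hk x => by
    rw [hm₁ k hk, logDer_one]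
  have hlogc : ∀ x, logDer (m c) (τ c) x = 1 / (x - τ c 0) := fun x => by rw [hmc, logDer_one]
  have hout : ∀ k < R, ∀ x, outgoing R m τ k x = 1 / (x - τ (k + 1) 0) := fun k hk x => by
    rw [outgoing, if_pos (by omega), hlog _ hk]
  have hout' : ∀ x, outgoing R m τ R x = 1 / (x - τ c 0) := fun x => by
    rw [outgoing, if_neg (by omega)]
    rcases hc with rfl | rfl
    · rw [hlogc, hm₀ (R + 2) (by omega) (by omega), logDer_zero, add_zero]
    · rw [hlogc, hm₀ (R + 1) (by omega) (by omega), logDer_zero, zero_add]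
  constructor
  · intro h
    have hne : τ c 0 ≠ τ R 0 := by
      rcases hc with rfl | rfl
      · exact ((h.ne_fork 0 (h0 le_rfl)).1 0 h0c).symm
      · exact ((h.ne_fork 0 (h0 le_rfl)).2 0 h0c).symm
    have heq := h.eq_end c hc 0 h0c
    rw [hlog R le_rfl, hlogc] at heq
    obtain ⟨hlc, -, hτc⟩ := (leaf_iff (natCast_add_one_ne_zero _)).1 ⟨hne, by simpa using heq⟩
    refine ⟨⟨hτ, fun k hk => h.ne_adj k (by omega) 0 (h0 hk) 0 (h0 hk.le),
      fun k hk => h.ne_zero k (by omega) 0 (h0 hk), fun k hk => ?_, ?_⟩,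
      Nat.cast_ne_zero.1 hlc, hτc⟩
    · have := h.eq k (by omega) 0 (h0 (by omega))
      rw [hlog k (by omega), hlog (k + 1) (by omega), hout (k + 1) (by omega)] at this
      simpa using this
    · rintro k rfl
      have := h.eq k (by omega) 0 (h0 le_rfl)
      rw [hlog k (by omega), hlog (k + 1) (by omega), hout', hτc,
        one_div_sub_ratio (natCast_add_one_ne_zero _)] at this
      simpa using this
  · rintro ⟨h, hlc, hτc⟩
    have hsR : τ R 0 ≠ 0 := h.solution.ne_zero le_rfl
    obtain ⟨hne, heq⟩ := (leaf_iff (natCast_add_one_ne_zero _)).2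
      ⟨Nat.cast_ne_zero.2 hlc, hsR, hτc⟩
    have hc₀ : τ c 0 ≠ 0 := by
      rw [hτc]
      exact mul_ne_zero (ratio_ne_zero (Nat.cast_ne_zero.2 hlc) (natCast_add_one_ne_zero _)) hsR
    refine ⟨?_, ?_, ?_, ?_, ?_, ?_⟩
    · intro k _ a ha
      obtain ⟨hk | hk, rfl⟩ := hlt ha
      · exact h.ne_zero k hk
      · exact fun _ => by rwa [hk]
    · intro k _ a ha b hb
      have := (hlt ha).2
      have := (hlt hb).2
      omega
    · intro k hk a ha b hb
      obtain ⟨-, rfl⟩ := hlt ha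
      obtain ⟨-, rfl⟩ := hlt hb
      exact h.ne_adj k hk
    · intro a ha
      obtain ⟨-, rfl⟩ := hlt ha
      constructor <;> intro b hb <;> obtain ⟨hk, rfl⟩ := hlt hb
      · rw [show R + 1 = c by omega]; exact hne.symm
      · rw [show R + 2 = c by omega]; exact hne.symm
    · intro k hk a ha
      obtain ⟨-, rfl⟩ := hlt ha
      rw [hlog k (by omega), hlog (k + 1) (by omega)]
      rcases (Nat.succ_le_of_lt hk).lt_or_eq with hk | rfl
      · rw [hout _ hk]
        simpa using h.eq k hk
      · rw [Nat.succ_eq_add_one] at *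
        rw [hout', hτc, one_div_sub_ratio (natCast_add_one_ne_zero _)]
        simpa using h.eq_last k rfl
    · intro k hk a ha
      obtain ⟨hk' | rfl, rfl⟩ := hlt ha
      · omega
      · rw [hlog R le_rfl, hlogc]
        simpa using heq

/-- The first variables of the colors `n + 1, n + 2, …`, up to the color `R + 1`. -/
def leftRoots (τ : ℕ → ℕ → ℂ) (n j : ℕ) : ℂ := τ (n + j + 1) 0

/-- The second variables of the colors `n + 1, …, R`, followed by the variable of color `R + 2`. -/
def rightRoots (R : ℕ) (τ : ℕ → ℕ → ℂ) (n j : ℕ) : ℂ :=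
  if n + j < R then τ (n + j + 1) 1 else τ (R + 2) 0

/-- The tail depends on the head only through the root T of color n and is solved first;
`TailSolution.pairLog_start` then supplies the additional weight M + 2 of the head. For N = 0 the
tail consists of the two leaves alone, and for n = 0 the root T is the point 1. -/
theorem colorSystem_iff_tail {N : ℕ} (hN : n + N = R) (hτ : τ 0 0 = 1)
    (hm₁ : ∀ k ≤ n, m k = 1) (hm₂ : ∀ k, n < k → k ≤ R → m k = 2) (hm₃ : m (R + 1) = 1)
    (hm₄ : m (R + 2) = 1) {w : ℕ → ℕ} (hw : ∀ j, w j = lam (n + j + 1)) :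
    ColorSystem R lam m τ ↔
      HeadSystem n lam (tailWeight N w (lam (R + 1)) (lam (R + 2)) + 2) (fun k => τ k 0) ∧
        TailSystem N w (lam (R + 1)) (lam (R + 2)) (τ n 0) (leftRoots τ n) (rightRoots R τ n) := by
  subst hN
  have hl : ∀ j, leftRoots τ n j = τ (n + j + 1) 0 := fun _ => rfl
  have hlN : leftRoots τ n N = τ (n + N + 1) 0 := rfl
  have hr : ∀ j < N, rightRoots (n + N) τ n j = τ (n + j + 1) 1 := fun j hj =>
    if_pos (by omega)
  have hrN : rightRoots (n + N) τ n N = τ (n + N + 2) 0 := if_neg (by omega)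
  have hlog : ∀ k ≤ n, ∀ x, logDer (m k) (τ k) x = 1 / (x - τ k 0) := fun k hk x => by
    rw [hm₁ k hk, logDer_one]
  have hlog₂ : ∀ j < N, ∀ x, logDer (m (n + j + 1)) (τ (n + j + 1)) x
      = pairLog (leftRoots τ n j) (rightRoots (n + N) τ n j) x := fun j hj x => by
    rw [hm₂ _ (by omega) (by omega), logDer_two, hl, hr j hj]
  have hinc : ∀ j ≤ N, ∀ x, logDer (m (n + j)) (τ (n + j)) x
      = incoming (τ n 0) (leftRoots τ n) (rightRoots (n + N) τ n) j x := by
    intro j hj x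
    cases j with
    | zero => exact hlog n le_rfl x
    | succ j => exact hlog₂ j hj x
  have hout : ∀ j ≤ N, ∀ x, outgoing (n + N) m τ (n + j) x
      = pairLog (leftRoots τ n j) (rightRoots (n + N) τ n j) x := by
    intro j hj x
    rcases hj.lt_or_eq with hj | rfl
    · rw [outgoing, if_pos (by omega), hlog₂ j hj]
    · rw [outgoing, if_neg (by omega), hm₃, hm₄, logDer_one, logDer_one, hlN, hrN, pairLog]
  have hout₁ : ∀ k < n, ∀ x, outgoing (n + N) m τ k x = 1 / (x - τ (k + 1) 0) := fun k hk x => by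
    rw [outgoing, if_pos (by omega), hlog _ hk]
  have h₁ : ∀ k ≤ n, 0 < m k := fun k hk => by simp [hm₁ _ hk]
  have h₂ : ∀ j < N, 0 < m (n + j + 1) ∧ 1 < m (n + j + 1) := fun j hj => by
    simp [hm₂ (n + j + 1) (by omega) (by omega)]
  have h₃ : 0 < m (n + N + 1) := by simp [hm₃]
  have h₄ : 0 < m (n + N + 2) := by simp [hm₄]
  constructor
  · intro h
    have hne : ∀ j ≤ N, ∀ c < m (n + j), τ (n + j) c ≠ leftRoots τ n j ∧
        τ (n + j) c ≠ rightRoots (n + N) τ n j := by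
      intro j hj c hc
      rcases hj.lt_or_eq with hj | rfl
      · rw [hl, hr j hj]
        exact ⟨(h.ne_adj (n + j) (by omega) 0 (h₂ j hj).1 c hc).symm,
          (h.ne_adj (n + j) (by omega) 1 (h₂ j hj).2 c hc).symm⟩
      · rw [hlN, hrN]
        exact ⟨(h.ne_fork c hc).1 0 h₃, (h.ne_fork c hc).2 0 h₄⟩
    have htail : TailSystem N w (lam (n + N + 1)) (lam (n + N + 2)) (τ n 0) (leftRoots τ n)
        (rightRoots (n + N) τ n) := by
      refine ⟨?_, ?_, ?_, ?_, ?_, ?_, ?_, ?_⟩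
      · intro j hj
        rw [hl, hr j hj]
        exact h.ne_self (n + j) (by omega) 0 (h₂ j hj).1 1 (h₂ j hj).2 (by omega)
      · have := hne 0 (by omega) 0 (h₁ n le_rfl)
        exact ⟨this.1.symm, this.2.symm⟩
      · intro j hj
        have ha := hne (j + 1) hj 0 (h₂ j hj).1
        have hb := hne (j + 1) hj 1 (h₂ j hj).2
        rw [hl j, hr j hj]
        exact ⟨ha.1, ha.2, hb.1, hb.2⟩
      · intro j hj hwj
        rw [hw] at hwj
        rw [hl, hr j hj]
        exact ⟨h.ne_zero (n + j) (by omega) 0 (h₂ j hj).1 hwj,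
          h.ne_zero (n + j) (by omega) 1 (h₂ j hj).2 hwj⟩
      · rw [hlN, hrN]
        exact ⟨h.ne_zero (n + N) (by omega) 0 h₃, h.ne_zero (n + N + 1) (by omega) 0 h₄⟩
      · intro j hj
        have := h.eq (n + j) (by omega) 0 (h₂ j hj).1
        rw [hinc j hj.le, add_assoc n j 1, hout (j + 1) hj, ← add_assoc, hlog₂ j hj, ← hw,
          ← hl] at this
        rw [← this]
        simp [pairLog]
        ring
      · intro j hj
        have := h.eq (n + j) (by omega) 1 (h₂ j hj).2
        rw [hinc j hj.le, add_assoc n j 1, hout (j + 1) hj, ← add_assoc, hlog₂ j hj, ← hw,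
          ← hr j hj] at this
        rw [← this]
        simp [pairLog]
        ring
      · rw [hlN, hrN, ← hinc N le_rfl, ← hinc N le_rfl]
        have ha := h.eq_end _ (Or.inl rfl) 0 h₃
        have hb := h.eq_end _ (Or.inr rfl) 0 h₄
        rw [hm₃, logDer_one] at ha
        rw [hm₄, logDer_one] at hb
        exact ⟨by simpa using ha, by simpa using hb⟩
    refine ⟨⟨hτ, fun k hk => h.ne_adj k (by omega) 0 (h₁ _ hk) 0 (h₁ _ hk.le),
      fun k hk => h.ne_zero k (by omega) 0 (h₁ _ hk), fun k hk => ?_, ?_⟩, htail⟩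
    · have := h.eq k (by omega) 0 (h₁ _ (by omega))
      rw [hlog k (by omega), hlog (k + 1) (by omega), hout₁ (k + 1) (by omega)] at this
      simpa using this
    · rintro k rfl
      have := h.eq k (by omega) 0 (h₁ _ le_rfl)
      have ho := hout 0 (by omega)
      rw [add_zero] at ho
      rw [hlog k (by omega), hlog (k + 1) (by omega), ho, htail.solution.pairLog_start] at this
      simpa using this
  · rintro ⟨h, ht⟩
    have hlt₁ : ∀ {k a : ℕ}, k ≤ n → a < m k → a = 0 := by
      intro k a hk ha
      rw [hm₁ k hk] at ha
      omega
    have hlt₂ : ∀ {j a : ℕ}, j < N → a < m (n + j + 1) →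
        τ (n + j + 1) a = leftRoots τ n j ∧ a = 0 ∨
        τ (n + j + 1) a = rightRoots (n + N) τ n j ∧ a = 1 := by
      intro j a hj ha
      rw [hm₂ _ (by omega) (by omega)] at ha
      obtain rfl | rfl : a = 0 ∨ a = 1 := by omega
      · exact Or.inl ⟨rfl, rfl⟩
      · exact Or.inr ⟨(hr j hj).symm, rfl⟩
    have hlt₃ : ∀ {a : ℕ}, a < m (n + N + 1) → a = 0 := by
      intro a ha
      rw [hm₃] at ha
      omega
    have hlt₄ : ∀ {a : ℕ}, a < m (n + N + 2) → a = 0 := by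
      intro a ha
      rw [hm₄] at ha
      omega
    have hcol : ∀ k < n + N + 2, k < n ∨ (∃ j < N, k = n + j) ∨ k = n + N ∨ k = n + N + 1 := by
      intro k hk
      by_cases h1 : k < n
      · exact Or.inl h1
      · by_cases h2 : k < n + N
        · exact Or.inr (Or.inl ⟨k - n, by omega, by omega⟩)
        · omega
    have hne : ∀ j ≤ N, ∀ c < m (n + j), τ (n + j) c ≠ leftRoots τ n j ∧
        τ (n + j) c ≠ rightRoots (n + N) τ n j := by
      intro j hj c hc
      cases j with
      | zero =>
        obtain rfl := hlt₁ (k := n) le_rfl hc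
        exact ⟨ht.ne_start.1.symm, ht.ne_start.2.symm⟩
      | succ j =>
        obtain ⟨ha, ha', hb, hb'⟩ := ht.ne_adj j hj
        rcases hlt₂ hj hc with ⟨h', -⟩ | ⟨h', -⟩
        · rw [← add_assoc, h']; exact ⟨ha, ha'⟩
        · rw [← add_assoc, h']; exact ⟨hb, hb'⟩
    refine ⟨?_, ?_, ?_, ?_, ?_, ?_⟩
    · intro k hk a ha
      rcases hcol k hk with hk | ⟨j, hj, rfl⟩ | rfl | rfl
      · obtain rfl := hlt₁ hk ha
        exact h.ne_zero k hk
      · have := ht.ne_zero j hj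
        rw [hw] at this
        rcases hlt₂ hj ha with ⟨h', -⟩ | ⟨h', -⟩
        · rw [h']; exact fun hl => (this hl).1
        · rw [h']; exact fun hl => (this hl).2
      · obtain rfl := hlt₃ ha
        exact ht.ne_zero_last.1
      · obtain rfl := hlt₄ ha
        rw [show τ (n + N + 1 + 1) 0 = rightRoots (n + N) τ n N from hrN.symm]
        exact ht.ne_zero_last.2
    · intro k hk a ha b hb hab
      rcases hcol k hk with hk | ⟨j, hj, rfl⟩ | rfl | rfl
      · exact absurd ((hlt₁ hk ha).trans (hlt₁ hk hb).symm) hab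
      · rcases hlt₂ hj ha with ⟨h', ha₀⟩ | ⟨h', ha₀⟩ <;>
          rcases hlt₂ hj hb with ⟨h'', hb₀⟩ | ⟨h'', hb₀⟩
        · omega
        · rw [h', h'']; exact ht.ne_self j hj
        · rw [h', h'']; exact (ht.ne_self j hj).symm
        · omega
      · exact absurd ((hlt₃ ha).trans (hlt₃ hb).symm) hab
      · exact absurd ((hlt₄ ha).trans (hlt₄ hb).symm) hab
    · intro k hk a ha b hb
      rcases hcol k (by omega) with hk | ⟨j, hj, rfl⟩ | rfl | rfl
      · obtain rfl := hlt₁ hk ha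
        obtain rfl := hlt₁ hk.le hb
        exact h.ne_adj k hk
      · have := hne j hj.le b hb
        rcases hlt₂ hj ha with ⟨h', -⟩ | ⟨h', -⟩
        · rw [h']; exact this.1.symm
        · rw [h']; exact this.2.symm
      · omega
      · omega
    · intro a ha
      have := hne N le_rfl a ha
      rw [hlN, hrN] at this
      constructor <;> intro b hb
      · rw [hlt₃ hb]; exact this.1
      · rw [hlt₄ hb]; exact this.2
    · intro k hk a ha
      rcases hcol k (by omega) with hk | ⟨j, hj, rfl⟩ | rfl | rfl
      · obtain rfl := hlt₁ hk ha
        rw [hlog k hk.le, hlog (k + 1) hk]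
        rcases (Nat.succ_le_of_lt hk).lt_or_eq with hk | hk
        · rw [hout₁ _ hk]
          simpa using h.eq k hk
        · rw [Nat.succ_eq_add_one] at hk
          subst hk
          have ho := hout 0 (by omega)
          rw [add_zero] at ho
          rw [ho, ht.solution.pairLog_start]
          simpa using h.eq_last k rfl
      · rw [hinc j hj.le, add_assoc n j 1, hout (j + 1) hj, ← add_assoc, hlog₂ j hj, ← hw]
        rcases hlt₂ hj ha with ⟨h', -⟩ | ⟨h', -⟩
        · rw [h', ← ht.eq_left j hj]
          simp [pairLog]
          ring
        · rw [h', ← ht.eq_right j hj]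
          simp [pairLog]
          ring
      · omega
      · omega
    · have hlast := ht.eq_last
      rw [hlN, hrN, ← hinc N le_rfl, ← hinc N le_rfl] at hlast
      rintro k (rfl | rfl) a ha
      · obtain rfl := hlt₃ ha
        rw [hm₃, logDer_one]
        simpa using hlast.1
      · obtain rfl := hlt₄ ha
        rw [hm₄, logDer_one]
        simpa using hlast.2

end BetheAnsatz

end

noncomputable section

namespace BetheAnsatz


/-! ### Polynomials and their roots -/

/-- Equal products have equal multisets of roots. For each value the two fibres are then
equinumerous, and bijections between fibres glue to a permutation of the indices. -/
theorem sameOrbit_of_representingPoly_eq {r : ℕ} {l : Fin r → ℕ} {t t' : Var l → ℂ}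
    (h : ∀ i, representingPoly t i = representingPoly t' i) : SameOrbit t t' := by
  have key : ∀ {n : ℕ} (f g : Fin n → ℂ), ∏ a, (X - C (f a)) = ∏ a, (X - C (g a)) →
      ∃ σ : Equiv.Perm (Fin n), ∀ a, g a = f (σ a) := by
    intro n f g hfg
    have hroots : ∀ f : Fin n → ℂ, (∏ a, (X - C (f a))).roots = Finset.univ.val.map f := by
      intro f
      rw [Finset.prod_eq_multiset_prod, ← Function.comp_def (fun c : ℂ => X - C c) f,
        ← Multiset.map_map, roots_multiset_prod_X_sub_C]
    have h₁ : Finset.univ.val.map f = Finset.univ.val.map g := by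
      rw [← hroots, ← hroots, hfg]
    have h₂ : ∀ c : ℂ, Fintype.card {a // f a = c} = Fintype.card {a // g a = c} := by
      intro c
      have := congrArg (Multiset.count c) h₁
      rw [Multiset.count_map, Multiset.count_map] at this
      rw [Fintype.card_subtype, Fintype.card_subtype, Finset.card_def, Finset.card_def,
        Finset.filter_val, Finset.filter_val]
      simpa only [eq_comm] using this
    let e' := fun c => Fintype.equivOfCardEq (h₂ c)
    refine ⟨(Equiv.sigmaFiberEquiv g).symm.trans ((Equiv.sigmaCongrRight fun c =>
      ((e' c).symm : {a // g a = c} ≃ {a // f a = c})).trans (Equiv.sigmaFiberEquiv f)), ?_⟩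
    intro a
    exact ((e' (g a)).symm ⟨a, rfl⟩).2.symm
  choose σ hσ using fun i => key (fun a => t ⟨i, a⟩) (fun a => t' ⟨i, a⟩) (h i)
  exact ⟨σ, hσ⟩

theorem exists_eq_prod_X_sub_C {p : ℂ[X]} {n : ℕ} (hp : p.Monic) (hn : p.natDegree = n) :
    ∃ f : Fin n → ℂ, ∏ a, (X - C (f a)) = p := by
  have hs := IsAlgClosed.splits p
  have hc : p.roots.toList.length = n := by
    rw [Multiset.length_toList, ← hn]
    exact (splits_iff_card_roots.1 hs)
  subst hc
  refine ⟨fun a => p.roots.toList.get a, ?_⟩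
  have h₁ := prod_multiset_X_sub_C_of_monic_of_roots_card_eq hp (splits_iff_card_roots.1 hs)
  conv_rhs => rw [← h₁, ← Multiset.coe_toList p.roots, Multiset.map_coe, Multiset.prod_coe]
  rw [← List.prod_ofFn]
  congr 1
  conv_rhs => rw [← List.ofFn_get p.roots.toList]
  rw [List.map_ofFn]
  rfl

theorem X_sub_C_mul_X_sub_C_eq_iff {a b S P : ℂ} :
    (X - C a) * (X - C b) = X ^ 2 - C S * X + C P ↔ a + b = S ∧ a * b = P := by
  have h : (X - C a) * (X - C b) = X ^ 2 - C (a + b) * X + C (a * b) := by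
    rw [C_add, C_mul]; ring
  constructor
  · intro h'
    rw [h] at h'
    have h₀ := congrArg (fun p => coeff p 0) h'
    have h₁ := congrArg (fun p => coeff p 1) h'
    simp [coeff_X, coeff_C] at h₀ h₁
    exact ⟨by linear_combination -h₁, h₀⟩
  · rintro ⟨rfl, rfl⟩
    exact h

theorem X_sub_C_eq_iff {a b : ℂ} : (X - C a = X - C b) ↔ a = b := by
  rw [sub_right_inj, C_inj]

theorem explicitPoly_monic_natDegree {r : ℕ} (hr : 4 ≤ r) (lam : Weight r) (L : LengthD r)
    (i : Fin r) : (explicitPoly lam L (i + 1)).Monic ∧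
      (explicitPoly lam L (i + 1)).natDegree = L.tuple i := by
  have hi := i.isLt
  have h₁ : ∀ c : ℂ, (X - C c).Monic ∧ (X - C c).natDegree = 1 := fun c =>
    ⟨monic_X_sub_C c, natDegree_X_sub_C c⟩
  have h₀ : (1 : ℂ[X]).Monic ∧ (1 : ℂ[X]).natDegree = 0 := ⟨monic_one, natDegree_one⟩
  have h₂ : ∀ S P : ℂ, (X ^ 2 - C S * X + C P).Monic ∧
      (X ^ 2 - C S * X + C P).natDegree = 2 := fun S P =>
    ⟨by monicity!, by compute_degree!⟩
  cases L with
  | ord l hl =>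
    simp only [explicitPoly, LengthD.tuple]
    split_ifs <;> first | omega | exact h₁ _ | exact h₀ | exact h₂ _ _
  | bar =>
    simp only [explicitPoly, LengthD.tuple]
    split_ifs <;> first | omega | exact h₁ _

/-- Index 0 is reserved for the point 1, regarded as the root of an additional color; values outside
the index set are arbitrary. -/
theorem exists_roots {r : ℕ} {l : Fin r → ℕ} (t : Var l → ℂ) :
    ∃ τ : ℕ → ℕ → ℂ, τ 0 0 = 1 ∧ ∀ i (a : Fin (l i)), t ⟨i, a⟩ = τ (i + 1) a := by
  refine ⟨fun k a => if k = 0 then 1 else if h : ∃ p : Var l, p.1.val + 1 = k ∧ p.2.val = a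
    then t h.choose else 0, by simp, fun i a => ?_⟩
  have h : ∃ p : Var l, p.1.val + 1 = i.val + 1 ∧ p.2.val = a.val := ⟨⟨i, a⟩, rfl, rfl⟩
  simp only [Nat.add_eq_zero_iff, one_ne_zero, and_false, if_false, dif_pos h]
  congr 1
  obtain ⟨h₁, h₂⟩ := h.choose_spec
  generalize h.choose = p at *
  obtain ⟨j, b⟩ := p
  obtain rfl : j = i := Fin.ext (by simpa using h₁)
  obtain rfl : b = a := Fin.ext h₂
  rfl

theorem representingPoly_eq {r : ℕ} {l : Fin r → ℕ} {t : Var l → ℂ} {m : ℕ → ℕ} {τ : ℕ → ℕ → ℂ}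
    (hm : ∀ i, l i = m (i + 1)) (hτ : ∀ i (a : Fin (l i)), t ⟨i, a⟩ = τ (i + 1) a) (i : Fin r) :
    representingPoly t i = ∏ a ∈ Finset.range (m (i + 1)), (X - C (τ (i + 1) a)) := by
  rw [representingPoly, ← hm, ← Fin.prod_univ_eq_prod_range (fun a => X - C (τ (i + 1) a))]
  exact Finset.prod_congr rfl fun a _ => by rw [hτ]

/-! ### Admissible lengths -/

theorem isAdmissible_iff {R : ℕ} (hR : 2 ≤ R) {wt : Weight (R + 2)} {lam : ℕ → ℕ}
    (hlam : ∀ i, wt i = lam (i + 1)) {L : LengthD (R + 2)} {m : ℕ → ℕ} (hm₀ : m 0 = 1)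
    (hm : ∀ i, L.tuple i = m (i + 1)) :
    IsAdmissible wt L ↔ ∀ k < R + 2, 0 ≤ (lam (k + 1) : ℤ) +
      if k + 1 < R then (m k + m (k + 2) - 2 * m (k + 1) : ℤ)
      else if k + 1 = R then (m k + (m (R + 1) + m (R + 2)) - 2 * m (k + 1) : ℤ)
      else (m R - 2 * m (k + 1) : ℤ) := by
  have hz : ∀ z : ℤ, (∃ n : ℕ, (z : ℂ) = n) ↔ 0 ≤ z := by
    intro z
    constructor
    · rintro ⟨n, hn⟩
      have : z = n := by exact_mod_cast hn
      omega
    · intro h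
      exact ⟨z.toNat, by rw [← Int.cast_natCast, Int.toNat_of_nonneg h]⟩
  rw [IsAdmissible, IsDominantIntegral]
  have : ∀ P : ℕ → Prop, (∀ k < R + 2, P k) ↔ ∀ i : Fin (R + 2), P i := fun P =>
    ⟨fun h i => h i i.isLt, fun h k hk => h ⟨k, hk⟩⟩
  rw [this]
  refine forall_congr' fun i => ?_
  rw [← hz]
  have h₁ := sum_cartanMatrix_D hR i fun k => (m k : ℂ)
  have h₂ : (wt + omegaOne (R + 2) - ∑ j : Fin (R + 2), (L.tuple j : ℂ) •
      simpleRoot (CartanMatrix.D (R + 2)) j) i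
      = lam (i + 1) + (omegaOne (R + 2) i * (m 0 : ℂ)
        - ∑ j : Fin (R + 2), (CartanMatrix.D (R + 2) i j : ℂ) * (m (j + 1) : ℂ)) := by
    simp only [Pi.sub_apply, Pi.add_apply, Finset.sum_apply, Pi.smul_apply, smul_eq_mul, hm,
      hm₀, hlam, simpleRoot]
    simp only [mul_comm ((m _ : ℕ) : ℂ)]
    push_cast
    ring
  rw [h₂, h₁]
  push_cast
  rfl

/-! ### The labels -/

section Labels

variable {r : ℕ} {wt : Weight r} {lam : ℕ → ℕ}

theorem lab_eq (hlam : ∀ i, wt i = lam (i + 1)) {k : ℕ} (h₁ : 1 ≤ k) (h₂ : k ≤ r) : lab wt k = lam k := by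
  rw [lab, dif_pos ⟨h₁, h₂⟩, hlam]
  congr 2
  simp; omega

theorem labSum_eq (hlam : ∀ i, wt i = lam (i + 1)) {a b : ℕ} (ha : 1 ≤ a) (hb : b ≤ r) :
    labSum wt a b = (∑ j ∈ Finset.Icc a b, lam j : ℕ) := by
  rw [labSum, Nat.cast_sum]
  refine Finset.sum_congr rfl fun j hj => ?_
  rw [Finset.mem_Icc] at hj
  exact lab_eq hlam (by omega) (by omega)

end Labels

end BetheAnsatz

end

/-! ### Lengths with at most one occupied branch of the fork -/

noncomputable section

namespace BetheAnsatz


variable {R : ℕ} {wt : Weight (R + 2)} {lam : ℕ → ℕ}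

theorem headWeight_cast (hlam : ∀ i, wt i = lam (i + 1)) {n W i : ℕ} (hn : n ≤ R + 2)
    (hi : 1 ≤ i) (hin : i ≤ n) : (headWeight n lam W i : ℂ) = labSum wt i n + W + n - i := by
  rw [headWeight, labSum_eq hlam hi hn]
  push_cast [Nat.cast_sub hin]
  ring

theorem representingPoly_eq_explicitPoly_iff {L : LengthD (R + 2)} {t : Var L.tuple → ℂ}
    {m : ℕ → ℕ} {τ : ℕ → ℕ → ℂ} (hm : ∀ i, L.tuple i = m (i + 1))
    (hτ : ∀ i (a : Fin (L.tuple i)), t ⟨i, a⟩ = τ (i + 1) a) :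
    (∀ i : Fin (R + 2), representingPoly t i = explicitPoly wt L (i + 1)) ↔
      ∀ k, 1 ≤ k → k ≤ R + 2 →
        ∏ a ∈ Finset.range (m k), (X - C (τ k a)) = explicitPoly wt L k := by
  constructor
  · intro h k h₁ h₂
    obtain ⟨j, rfl⟩ : ∃ j, k = j + 1 := ⟨k - 1, by omega⟩
    have := h ⟨j, h₂⟩
    rwa [representingPoly_eq hm hτ] at this
  · intro h i
    rw [representingPoly_eq hm hτ]
    exact h _ (by omega) (by omega)

/-- The only label that decreases is the n-th one, by 1. Hence admissibility for n > 0 is `lam n ≠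
0`, the nonvanishing of the last head weight. -/
theorem isSolutionD_iff_of_le (hR : 2 ≤ R) (hlam : ∀ i, wt i = lam (i + 1)) {n : ℕ} (hn : n ≤ R)
    (hl : n ≤ 2 * (R + 2) - 2) (t : Var (LengthD.ord n hl : LengthD (R + 2)).tuple → ℂ) :
    IsSolutionD wt _ t ↔ IsAdmissible wt (.ord n hl) ∧
      ∀ i : Fin (R + 2), representingPoly t i = explicitPoly wt (.ord n hl) (i + 1) := by
  obtain ⟨τ, hτ₀, hτ⟩ := exists_roots t
  let m : ℕ → ℕ := fun k => if k ≤ n then 1 else 0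
  have hm₁ : ∀ k ≤ n, m k = 1 := fun k hk => if_pos hk
  have hm₀ : ∀ k, n < k → m k = 0 := fun k hk => if_neg (by omega)
  have hm : ∀ i, (LengthD.ord n hl : LengthD (R + 2)).tuple i = m (i + 1) := fun i => by
    simp [LengthD.tuple, m, show n ≤ R + 1 by omega]
  have hex : ∀ k, explicitPoly wt (.ord n hl) k = if k ≤ n then X - C (cLow wt n k) else 1 := by
    intro k
    rw [explicitPoly, if_pos (by omega)]
  have hc : ∀ k, cLow wt n k = ∏ i ∈ Finset.Icc 1 k, ratio (labSum wt i n + n - i) := fun _ => rfl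
  have hhead : ∀ k ≤ n, cLow wt n k = ∏ i ∈ Finset.Icc 1 k, ratio (headWeight n lam 0 i) := by
    intro k hk
    refine Finset.prod_congr rfl fun i hi => ?_
    rw [Finset.mem_Icc] at hi
    rw [headWeight_cast hlam (by omega) hi.1 (by omega)]
    simp
  rw [isSolutionD_iff hR hlam (hm₁ 0 (by omega)) hτ₀ hm hτ,
    colorSystem_iff_head hn hτ₀ hm₁ hm₀, headSystem_iff,
    isAdmissible_iff hR hlam (hm₁ 0 (by omega)) hm, representingPoly_eq_explicitPoly_iff hm hτ]
  constructor
  · rintro ⟨h₁, h₂⟩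
    refine ⟨fun k hk => ?_, fun k hk₁ hk₂ => ?_⟩
    · have : k + 1 = n → lam (k + 1) ≠ 0 := by
        rintro rfl
        simpa using h₁ (by omega)
      simp only [m]
      split_ifs <;> push_cast <;> omega
    · rw [hex]
      split_ifs with h
      · rw [hm₁ k h, hhead k h, ← h₂ k h]
        simp
      · rw [hm₀ k (by omega)]
        simp
  · rintro ⟨h₁, h₂⟩
    refine ⟨fun hn0 => ?_, fun k hk => ?_⟩
    · obtain ⟨k, rfl⟩ : ∃ k, n = k + 1 := ⟨n - 1, by omega⟩
      have := h₁ k (by omega)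
      simp only [m] at this
      split_ifs at this <;> push_cast at this <;> omega
    · rcases Nat.eq_zero_or_pos k with rfl | hk₀
      · simpa using hτ₀
      · have := h₂ k hk₀ (by omega)
        rw [hex, if_pos hk, hm₁ k hk, Finset.prod_range_one, X_sub_C_eq_iff] at this
        rw [this, hhead k hk]

/-- The case of a single variable of color `c` after the color `R`. -/
theorem isSolutionD_iff_of_leaf (hR : 2 ≤ R) (hlam : ∀ i, wt i = lam (i + 1)) {c : ℕ}
    (hc : c = R + 1 ∨ c = R + 2) (L : LengthD (R + 2))
    (hL : ∀ i, L.tuple i = if i.val + 1 ≤ R ∨ i.val + 1 = c then 1 else 0) {z : ℕ → ℂ}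
    (hz : ∀ k ≤ R, z k = ∏ i ∈ Finset.Icc 1 k, ratio (labSum wt i R + lab wt c + R + 1 - i))
    (hex : ∀ k, 1 ≤ k → k ≤ R + 2 → explicitPoly wt L k = if k ≤ R then X - C (z k)
      else if k = c then X - C (ratio (lab wt c) * z R) else 1)
    (t : Var L.tuple → ℂ) :
    IsSolutionD wt L.tuple t ↔ IsAdmissible wt L ∧
      ∀ i : Fin (R + 2), representingPoly t i = explicitPoly wt L (i + 1) := by
  obtain ⟨τ, hτ₀, hτ⟩ := exists_roots t
  let m : ℕ → ℕ := fun k => if k ≤ R ∨ k = c then 1 else 0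
  have hm₁ : ∀ k ≤ R, m k = 1 := fun k hk => if_pos (Or.inl hk)
  have hmc : m c = 1 := if_pos (Or.inr rfl)
  have hm₀ : ∀ k, R < k → k ≠ c → m k = 0 := fun k hk hkc => if_neg (by omega)
  have hm : ∀ i, L.tuple i = m (i + 1) := hL
  have hlc : lab wt c = lam c := lab_eq hlam (by omega) (by omega)
  have hhead : ∀ k ≤ R, z k = ∏ i ∈ Finset.Icc 1 k, ratio (headWeight R lam (lam c + 1) i) := by
    intro k hk
    rw [hz k hk]
    refine Finset.prod_congr rfl fun i hi => ?_
    rw [Finset.mem_Icc] at hi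
    rw [headWeight_cast hlam (by omega) hi.1 (by omega), hlc]
    push_cast
    congr 1
    ring
  rw [isSolutionD_iff hR hlam (hm₁ 0 (by omega)) hτ₀ hm hτ,
    colorSystem_iff_leaf hc hτ₀ hm₁ hmc hm₀, headSystem_iff,
    isAdmissible_iff hR hlam (hm₁ 0 (by omega)) hm, representingPoly_eq_explicitPoly_iff hm hτ]
  constructor
  · rintro ⟨h, hlc₀, hτc⟩
    refine ⟨fun k hk => ?_, fun k hk₁ hk₂ => ?_⟩
    · have : k + 1 = c → lam (k + 1) ≠ 0 := by
        rintro rfl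
        exact hlc₀
      simp only [m]
      split_ifs <;> push_cast <;> omega
    · rw [hex k hk₁ hk₂]
      split_ifs with h₁ h₂
      · rw [hm₁ k h₁, hhead k h₁, ← h.formula k h₁]
        simp
      · rw [h₂, hmc, hhead R le_rfl, ← h.formula R le_rfl, hlc, hτc.symm]
        simp
      · rw [hm₀ k (by omega) h₂]
        simp
  · rintro ⟨h₁, h₂⟩
    have hform : ∀ k ≤ R, τ k 0 = ∏ i ∈ Finset.Icc 1 k, ratio (headWeight R lam (lam c + 1) i) := by
      intro k hk
      rcases Nat.eq_zero_or_pos k with rfl | hk₀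
      · simpa using hτ₀
      · have := h₂ k hk₀ (by omega)
        rw [hex k hk₀ (by omega), if_pos hk, hm₁ k hk, Finset.prod_range_one,
          X_sub_C_eq_iff] at this
        rw [this, hhead k hk]
    refine ⟨⟨by omega, hform⟩, ?_, ?_⟩
    · have := h₁ (c - 1) (by omega)
      rw [show c - 1 + 1 = c by omega, if_neg (by omega), if_neg (by omega), hm₁ R le_rfl,
        hmc] at this
      omega
    · have := h₂ c (by omega) (by omega)
      rw [hex c (by omega) (by omega), if_neg (by omega), if_pos rfl, hmc,
        Finset.prod_range_one, X_sub_C_eq_iff] at this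
      rw [this, hhead R le_rfl, hform R le_rfl, hlc]

theorem isSolutionD_iff_bar (hR : 2 ≤ R) (hlam : ∀ i, wt i = lam (i + 1))
    (t : Var (LengthD.bar : LengthD (R + 2)).tuple → ℂ) :
    IsSolutionD wt _ t ↔ IsAdmissible wt .bar ∧
      ∀ i : Fin (R + 2), representingPoly t i = explicitPoly wt .bar (i + 1) := by
  refine isSolutionD_iff_of_leaf hR hlam (c := R + 2) (Or.inr rfl) .bar ?_ (z := prodBar wt) ?_ ?_ t
  · intro i
    have hi := i.isLt
    simp only [LengthD.tuple]
    split_ifs <;> omega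
  · intro k _
    refine Finset.prod_congr rfl fun i _ => ?_
    rw [Nat.add_sub_cancel]
    push_cast
    congr 1
    ring
  · intro k h₁ h₂
    rw [explicitPoly]
    simp only [Nat.add_sub_cancel, show R + 2 - 1 = R + 1 by omega]
    split_ifs <;> first | omega | rfl

/-- For length r - 1 the last root lies on a branch of the fork, so this is the mirror image of the
barred length. Only the product formula has to be split at its last factor. -/
theorem isSolutionD_iff_pred (hR : 2 ≤ R) (hlam : ∀ i, wt i = lam (i + 1))
    (hl : R + 1 ≤ 2 * (R + 2) - 2) (t : Var (LengthD.ord (R + 1) hl : LengthD (R + 2)).tuple → ℂ) :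
    IsSolutionD wt _ t ↔ IsAdmissible wt (.ord (R + 1) hl) ∧
      ∀ i : Fin (R + 2), representingPoly t i = explicitPoly wt (.ord (R + 1) hl) (i + 1) := by
  have hz : ∀ k ≤ R, cLow wt (R + 1) k
      = ∏ i ∈ Finset.Icc 1 k, ratio (labSum wt i R + lab wt (R + 1) + R + 1 - i) := by
    intro k hk
    refine Finset.prod_congr rfl fun i hi => ?_
    rw [Finset.mem_Icc] at hi
    rw [labSum, Finset.sum_Icc_succ_top (by omega), labSum]
    push_cast
    congr 1
    ring
  refine isSolutionD_iff_of_leaf hR hlam (c := R + 1) (Or.inl rfl) (.ord (R + 1) hl) ?_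
    (z := cLow wt (R + 1)) hz ?_ t
  · intro i
    have hi := i.isLt
    simp only [LengthD.tuple]
    split_ifs <;> omega
  · intro k h₁ h₂
    rw [explicitPoly, if_pos (by omega)]
    split_ifs with h₃ h₄ h₅ h₅
    · rfl
    · subst h₅
      have : cLow wt (R + 1) (R + 1) = ratio (lab wt (R + 1)) * cLow wt (R + 1) R := by
        rw [cLow, Finset.prod_Icc_succ_top (by omega), mul_comm, cLow, labSum]
        simp
      rw [this]
    · omega
    · omega
    · omega
    · rfl

end BetheAnsatz

end

/-! ### Identification of the weights with the labels in the explicit formulas -/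

noncomputable section

namespace BetheAnsatz


variable {R : ℕ} {wt : Weight (R + 2)} {lam : ℕ → ℕ}

theorem prod_Icc_shift {n : ℕ} (f : ℕ → ℂ) (a b : ℕ) :
    ∏ i ∈ Finset.Icc (n + 1 + a) (n + b), f i = ∏ i ∈ Finset.Ico a b, f (n + 1 + i) := by
  rw [Finset.prod_Ico_add f a b (n + 1)]
  refine Finset.prod_congr ?_ fun _ _ => rfl
  ext i
  simp only [Finset.mem_Icc, Finset.mem_Ico]
  omega

section Formulas

variable {n N : ℕ} {w : ℕ → ℕ}

theorem labSum_eq_inducedWeight (hlam : ∀ i, wt i = lam (i + 1)) (hw : ∀ j, w j = lam (n + j + 1))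
    {j : ℕ} (hj : n + j ≤ R + 2) : labSum wt (n + 1) (n + j) + j = inducedWeight w j := by
  rw [labSum_eq hlam (by omega) hj, inducedWeight]
  push_cast
  congr 1
  have h := Finset.sum_Ico_add (fun i => (lam i : ℂ)) 0 j (n + 1)
  rw [Finset.range_eq_Ico]
  simp only [hw]
  rw [Finset.sum_congr (s₂ := Finset.Ico (0 + (n + 1)) (j + (n + 1))) ?_ fun _ _ => rfl, ← h]
  · exact Finset.sum_congr rfl fun i _ => by rw [show n + 1 + i = n + i + 1 by omega]
  · ext i
    simp only [Finset.mem_Icc, Finset.mem_Ico]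
    omega

theorem totalWeight_cast (hlam : ∀ i, wt i = lam (i + 1)) (hw : ∀ j, w j = lam (n + j + 1))
    {j : ℕ} (hj : n + j < R + 2) : (totalWeight w j : ℂ) = labSum wt (n + 1) (n + 1 + j) + j := by
  have h := labSum_eq_inducedWeight hlam hw (j := j + 1) hj
  rw [inducedWeight_succ] at h
  rw [totalWeight, show n + 1 + j = n + (j + 1) by omega]
  push_cast at h ⊢
  linear_combination -h

theorem tailWeight_cast (hlam : ∀ i, wt i = lam (i + 1)) (hw : ∀ j, w j = lam (n + j + 1))
    (hN : n + N = R) : (tailWeight N w (lam (R + 1)) (lam (R + 2)) : ℂ) =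
      2 * labSum wt (n + 1) R + lab wt (R + 1) + lab wt (R + 2) + 2 * N := by
  have h := labSum_eq_inducedWeight hlam hw (j := N) (by omega)
  rw [hN] at h
  rw [tailWeight, lab_eq hlam (by omega) (by omega), lab_eq hlam (by omega) le_rfl]
  push_cast
  rw [← h]
  ring

theorem labSum_add (a b c : ℕ) (hab : a ≤ b + 1) (hbc : b ≤ c) :
    labSum wt a b + labSum wt (b + 1) c = labSum wt a c := by
  have h : ∀ a b, Finset.Icc a b = Finset.Ico a (b + 1) := fun a b => by
    ext; simp only [Finset.mem_Icc, Finset.mem_Ico]; omega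
  simp only [labSum, h]
  exact Finset.sum_Ico_consecutive _ hab (by omega)

theorem dualWeight_cast (hlam : ∀ i, wt i = lam (i + 1)) (hw : ∀ j, w j = lam (n + j + 1))
    (hN : n + N = R) {j : ℕ} (hj : j < N) :
    (dualWeight N w (lam (R + 1)) (lam (R + 2)) j : ℂ) =
      labSum wt (n + 1) (n + 1 + j) + 2 * labSum wt (n + 1 + j + 1) R + lab wt (R + 1)
        + lab wt (R + 2) + 2 * N - j := by
  have h := totalWeight_add_dualWeight (w := w) (e := lam (R + 1)) (f := lam (R + 2)) hj
  have h' : (totalWeight w j : ℂ) + dualWeight N w (lam (R + 1)) (lam (R + 2)) j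
      = tailWeight N w (lam (R + 1)) (lam (R + 2)) := by exact_mod_cast h
  rw [tailWeight_cast hlam hw hN, totalWeight_cast hlam hw (by omega),
    ← labSum_add (n + 1) (n + 1 + j) R (by omega) (by omega)] at h'
  linear_combination h'

/-! The explicit formulas for the length `l = 2 r - 2 - n`, with `r = R + 2` and `n + N = R`. -/

theorem prodHigh₂_eq (hlam : ∀ i, wt i = lam (i + 1)) (hw : ∀ j, w j = lam (n + j + 1))
    (hN : n + N = R) {a b : ℕ} (hb : b ≤ N) :
    prodHigh₂ wt (n + 2 * N + 2) (n + 1 + a) (n + b) =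
      ∏ i ∈ Finset.Ico a b, ratio (dualWeight N w (lam (R + 1)) (lam (R + 2)) i) := by
  rw [prodHigh₂, prod_Icc_shift]
  refine Finset.prod_congr rfl fun i hi => ?_
  rw [Finset.mem_Ico] at hi
  rw [dualWeight_cast hlam hw hN (by omega), show 2 * (R + 2) - 1 - (n + 2 * N + 2) = n + 1 by omega]
  simp only [Nat.add_sub_cancel, show R + 2 - 1 = R + 1 by omega]
  push_cast
  congr 1
  ring

theorem prodHigh₃_eq (hlam : ∀ i, wt i = lam (i + 1)) (hw : ∀ j, w j = lam (n + j + 1))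
    (hN : n + N = R) {a : ℕ} :
    prodHigh₃ wt (n + 2 * N + 2) (n + 1 + a) R =
      ∏ i ∈ Finset.Ico a N, ratio (totalWeight w i) := by
  subst hN
  rw [prodHigh₃, prod_Icc_shift]
  refine Finset.prod_congr rfl fun i hi => ?_
  rw [Finset.mem_Ico] at hi
  rw [totalWeight_cast hlam hw (by omega),
    show 2 * (n + N + 2) - 1 - (n + 2 * N + 2) = n + 1 by omega]
  push_cast
  congr 1
  ring

theorem ratioHigh_eq (hlam : ∀ i, wt i = lam (i + 1)) (hw : ∀ j, w j = lam (n + j + 1))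
    (hN : n + N = R) {s : ℕ} (hs₁ : 1 ≤ s) (hs₂ : s ≤ R + 2) :
    ratioHigh wt (n + 2 * N + 2) s = ratio (lam s + inducedWeight w N : ℕ) := by
  have h := labSum_eq_inducedWeight hlam hw (j := N) (by omega)
  have hc : (R : ℂ) = n + N := by rw [← hN]; push_cast; rfl
  rw [ratioHigh, lab_eq hlam hs₁ hs₂, Nat.cast_add (lam s), ← h, Nat.add_sub_cancel, hN,
    show 2 * (R + 2) - 1 - (n + 2 * N + 2) = n + 1 by omega]
  push_cast
  rw [hc]
  congr 1
  ring

theorem prodHigh₁_eq (hlam : ∀ i, wt i = lam (i + 1)) (hw : ∀ j, w j = lam (n + j + 1))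
    (hN : n + N = R) {j : ℕ} (hj : j ≤ n) :
    prodHigh₁ wt (n + 2 * N + 2) j = ∏ i ∈ Finset.Icc 1 j,
      ratio (headWeight n lam (tailWeight N w (lam (R + 1)) (lam (R + 2)) + 2) i) := by
  refine Finset.prod_congr rfl fun i hi => ?_
  rw [Finset.mem_Icc] at hi
  rw [headWeight_cast hlam (by omega) hi.1 (by omega), Nat.cast_add (tailWeight _ _ _ _), tailWeight_cast hlam hw hN,
    show 2 * (R + 2) - 1 - (n + 2 * N + 2) = n + 1 by omega,
    show 2 * (R + 2) - 2 - (n + 2 * N + 2) = n by omega]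
  simp only [Nat.add_sub_cancel, show R + 2 - 1 = R + 1 by omega]
  push_cast
  congr 1
  ring

/-- Length r is the tail with N = 0; its separately stated formula agrees with the general head
weights for M = `lam (R + 1) + lam (R + 2)`. -/
theorem prodMid_eq (hlam : ∀ i, wt i = lam (i + 1)) {j : ℕ} (hj : j ≤ R) :
    prodMid wt j = ∏ i ∈ Finset.Icc 1 j,
      ratio (headWeight R lam (tailWeight 0 w (lam (R + 1)) (lam (R + 2)) + 2) i) := by
  refine Finset.prod_congr rfl fun i hi => ?_
  rw [Finset.mem_Icc] at hi
  rw [headWeight_cast hlam (by omega) hi.1 (by omega), tailWeight, inducedWeight_zero,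
    ← labSum_add i R (R + 2) (by omega) (by omega), ← labSum_add (R + 1) (R + 1) (R + 2) (by omega)
    (by omega), labSum_eq hlam (a := R + 1) (by omega) (by omega),
    labSum_eq hlam (a := R + 1 + 1) (by omega) (by omega)]
  simp
  congr 1
  ring

theorem tailPoint_eq (hlam : ∀ i, wt i = lam (i + 1)) (hw : ∀ j, w j = lam (n + j + 1))
    (hN : n + N = R) {j : ℕ} (hj : j ≤ N) :
    tailPoint N w (lam (R + 1)) (lam (R + 2)) (prodHigh₁ wt (n + 2 * N + 2) n) j =
      prodHigh₁ wt (n + 2 * N + 2) n * prodHigh₂ wt (n + 2 * N + 2) (n + 1) (n + j) := by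
  rw [tailPoint, ← add_zero (n + 1), prodHigh₂_eq hlam hw hN hj, Finset.range_eq_Ico]

theorem tailProd_eq (hlam : ∀ i, wt i = lam (i + 1)) (hw : ∀ j, w j = lam (n + j + 1))
    (hN : n + N = R) (j : ℕ) :
    tailProd N w (lam (R + 1)) (lam (R + 2)) j =
      ratioHigh wt (n + 2 * N + 2) (R + 1) * ratioHigh wt (n + 2 * N + 2) (R + 2) *
        (prodHigh₃ wt (n + 2 * N + 2) (n + 1 + j) R
          * prodHigh₂ wt (n + 2 * N + 2) (n + 1 + j) R) := by
  rw [tailProd, Finset.prod_mul_distrib, ratioHigh_eq hlam hw hN (by omega) (by omega),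
    ratioHigh_eq hlam hw hN (by omega) le_rfl, prodHigh₃_eq hlam hw hN]
  have := prodHigh₂_eq hlam hw hN (a := j) (b := N) le_rfl
  rw [hN] at this
  rw [this]

theorem abSum_eq (hlam : ∀ i, wt i = lam (i + 1)) (hw : ∀ j, w j = lam (n + j + 1))
    (hN : n + N = R) {j : ℕ} (hj : j ≤ N) :
    abSum wt (n + 2 * N + 2) (n + j + 1) = tailSum N w (lam (R + 1)) (lam (R + 2)) j *
      tailPoint N w (lam (R + 1)) (lam (R + 2)) (prodHigh₁ wt (n + 2 * N + 2) n) j := by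
  have hM : abNum wt (n + 2 * N + 2) = tailWeight N w (lam (R + 1)) (lam (R + 2)) := by
    have hc : (R : ℂ) = n + N := by rw [← hN]; push_cast; rfl
    rw [abNum, tailWeight_cast hlam hw hN,
      show 2 * (R + 2) - 1 - (n + 2 * N + 2) = n + 1 by omega]
    simp only [Nat.add_sub_cancel, show R + 2 - 1 = R + 1 by omega]
    push_cast
    rw [hc]
    ring
  rw [tailSum, tailPoint_eq hlam hw hN hj, tailProd_eq hlam hw hN, abSum, hM,
    show 2 * (R + 2) - 1 - (n + 2 * N + 2) = n + 1 by omega,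
    show 2 * (R + 2) - 2 - (n + 2 * N + 2) = n by omega, show n + 1 + j = n + j + 1 by omega]
  simp only [Nat.add_sub_cancel, show R + 2 - 1 = R + 1 by omega]
  ring

theorem abProd_eq (hlam : ∀ i, wt i = lam (i + 1)) (hw : ∀ j, w j = lam (n + j + 1))
    (hN : n + N = R) {j : ℕ} (hj : j ≤ N) :
    abProd wt (n + 2 * N + 2) (n + j + 1) = tailProd N w (lam (R + 1)) (lam (R + 2)) j *
      tailPoint N w (lam (R + 1)) (lam (R + 2)) (prodHigh₁ wt (n + 2 * N + 2) n) j ^ 2 := by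
  have hmul : prodHigh₂ wt (n + 2 * N + 2) (n + 1) R = prodHigh₂ wt (n + 2 * N + 2) (n + 1) (n + j)
      * prodHigh₂ wt (n + 2 * N + 2) (n + j + 1) R := by
    have h₁ := prodHigh₂_eq hlam hw hN (a := 0) (b := N) le_rfl
    have h₂ := prodHigh₂_eq hlam hw hN (a := 0) hj
    have h₃ := prodHigh₂_eq hlam hw hN (a := j) (b := N) le_rfl
    rw [hN, add_zero] at h₁
    rw [add_zero] at h₂
    rw [hN, show n + 1 + j = n + j + 1 by omega] at h₃
    rw [h₁, h₂, h₃, Finset.prod_Ico_consecutive _ (by omega) hj]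
  rw [tailPoint_eq hlam hw hN hj, tailProd_eq hlam hw hN, abProd,
    show 2 * (R + 2) - 1 - (n + 2 * N + 2) = n + 1 by omega,
    show 2 * (R + 2) - 2 - (n + 2 * N + 2) = n by omega, show n + 1 + j = n + j + 1 by omega]
  simp only [Nat.add_sub_cancel, show R + 2 - 1 = R + 1 by omega]
  rw [hmul]
  ring

theorem cHigh_eq (hlam : ∀ i, wt i = lam (i + 1)) (hw : ∀ j, w j = lam (n + j + 1))
    (hN : n + N = R) {s : ℕ} (hs₁ : 1 ≤ s) (hs₂ : s ≤ R + 2) :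
    cHigh wt (n + 2 * N + 2) s = ratio (lam s + inducedWeight w N : ℕ) *
      tailPoint N w (lam (R + 1)) (lam (R + 2)) (prodHigh₁ wt (n + 2 * N + 2) n) N := by
  rw [tailPoint_eq hlam hw hN le_rfl, cHigh, ratioHigh_eq hlam hw hN hs₁ hs₂, hN,
    show 2 * (R + 2) - 1 - (n + 2 * N + 2) = n + 1 by omega,
    show 2 * (R + 2) - 2 - (n + 2 * N + 2) = n by omega, Nat.add_sub_cancel]
  ring

end Formulas

end BetheAnsatz

end

/-! ### Lengths with both branches of the fork occupied, and all lengths together -/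

noncomputable section

namespace BetheAnsatz


variable {R : ℕ} {wt : Weight (R + 2)} {lam : ℕ → ℕ}

theorem isSolutionD_iff_of_tail (hR : 2 ≤ R) (hlam : ∀ i, wt i = lam (i + 1)) {n N : ℕ}
    (hN : n + N = R) (hl : n + 2 * N + 2 ≤ 2 * (R + 2) - 2)
    (t : Var (LengthD.ord (n + 2 * N + 2) hl : LengthD (R + 2)).tuple → ℂ) :
    IsSolutionD wt _ t ↔ IsAdmissible wt (.ord (n + 2 * N + 2) hl) ∧
      ∀ i : Fin (R + 2), representingPoly t i
        = explicitPoly wt (.ord (n + 2 * N + 2) hl) (i + 1) := by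
  obtain ⟨τ, hτ₀, hτ⟩ := exists_roots t
  let m : ℕ → ℕ := fun k => if k ≤ n then 1 else if k ≤ R then 2 else 1
  have hm₁ : ∀ k ≤ n, m k = 1 := fun k hk => if_pos hk
  have hm₂ : ∀ k, n < k → k ≤ R → m k = 2 := fun k h₁ h₂ => by simp [m, h₁, h₂]
  have hm₃ : ∀ k, R < k → m k = 1 := fun k h => by
    simp [m, show ¬ k ≤ n by omega, show ¬ k ≤ R by omega]
  have hm : ∀ i, (LengthD.ord (n + 2 * N + 2) hl : LengthD (R + 2)).tuple i = m (i + 1) := by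
    intro i
    simp only [LengthD.tuple, m]
    split_ifs <;> omega
  let w : ℕ → ℕ := fun j => lam (n + j + 1)
  have hw : ∀ j, w j = lam (n + j + 1) := fun _ => rfl
  let e := lam (R + 1)
  let f := lam (R + 2)
  let H : ℕ → ℂ := fun k => ∏ i ∈ Finset.Icc 1 k, ratio (headWeight n lam (tailWeight N w e f + 2) i)
  have hexHead : ∀ k ≤ n, explicitPoly wt (.ord (n + 2 * N + 2) hl) k = X - C (H k) := by
    intro k hk
    rw [explicitPoly, if_neg (by omega)]
    by_cases hN₀ : N = 0
    · subst hN₀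
      obtain rfl : n = R := by omega
      rw [if_pos (by omega), if_pos (by omega), prodMid_eq (w := w) hlam hk]
    · rw [if_neg (by omega), if_pos (by omega), prodHigh₁_eq hlam hw hN hk]
  have hexPair : ∀ j < N, explicitPoly wt (.ord (n + 2 * N + 2) hl) (n + j + 1)
      = X ^ 2 - C (tailSum N w e f j * tailPoint N w e f (H n) j) * X
        + C (tailProd N w e f j * tailPoint N w e f (H n) j ^ 2) := by
    intro j hj
    rw [explicitPoly, if_neg (by omega), if_neg (by omega), if_neg (by omega), if_pos (by omega),
      abSum_eq hlam hw hN hj.le, abProd_eq hlam hw hN hj.le, prodHigh₁_eq hlam hw hN le_rfl]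
  have hexEnd : ∀ s, s = R + 1 ∨ s = R + 2 → explicitPoly wt (.ord (n + 2 * N + 2) hl) s
      = X - C (ratio (lam s + inducedWeight w N : ℕ) * tailPoint N w e f (H n) N) := by
    intro s hs
    rw [explicitPoly, if_neg (by omega)]
    by_cases hN₀ : N = 0
    · subst hN₀
      rw [if_pos (by omega), if_neg (by omega), lab_eq hlam (by omega) (by omega),
        Nat.add_sub_cancel, prodMid_eq (w := w) hlam le_rfl, tailPoint_zero, inducedWeight_zero]
      obtain rfl : n = R := by omega
      rfl
    · rw [if_neg (by omega), if_neg (by omega), if_neg (by omega),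
        cHigh_eq hlam hw hN (by omega) (by omega), prodHigh₁_eq hlam hw hN le_rfl]
  -- The labels that decrease, each by 1, are those of the two branch colors if N = 0 and that of
  -- the first doubled color n + 1 otherwise.
  have hadm : IsAdmissible wt (.ord (n + 2 * N + 2) hl) ↔
      (N = 0 → e ≠ 0 ∧ f ≠ 0) ∧ (N ≠ 0 → w 0 ≠ 0) := by
    rw [isAdmissible_iff hR hlam (hm₁ 0 (by omega)) hm]
    constructor
    · intro h
      constructor
      · rintro rfl
        have h₁ := h R (by omega)
        have h₂ := h (R + 1) (by omega)
        rw [if_neg (by omega), if_neg (by omega), hm₁ R (by omega), hm₃ _ (by omega)] at h₁ h₂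
        rw [show R + 1 + 1 = R + 2 from rfl] at h₂
        simp only [e, f]
        omega
      · intro hN₀
        have h₁ := h n (by omega)
        simp only [w, add_zero]
        simp only [m] at h₁
        split_ifs at h₁ <;> push_cast at h₁ <;> omega
    · rintro ⟨h₁, h₂⟩ k hk
      simp only [w, add_zero] at h₂
      have h₂' : N ≠ 0 → k = n → lam (k + 1) ≠ 0 := by
        rintro h rfl
        exact h₂ h
      have h₁' : N = 0 → k = R → lam (k + 1) ≠ 0 := by
        rintro h rfl
        exact (h₁ h).1
      have h₁'' : N = 0 → k = R + 1 → lam (k + 1) ≠ 0 := by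
        rintro h rfl
        exact (h₁ h).2
      simp only [m]
      split_ifs <;> push_cast <;> omega
  rw [isSolutionD_iff hR hlam (hm₁ 0 (by omega)) hτ₀ hm hτ,
    colorSystem_iff_tail hN hτ₀ hm₁ hm₂ (hm₃ _ (by omega)) (hm₃ _ (by omega)) hw,
    headSystem_iff, tailSystem_iff, hadm, representingPoly_eq_explicitPoly_iff hm hτ]
  have hleft : leftRoots τ n N = τ (R + 1) 0 := by rw [leftRoots, hN]
  have hright : rightRoots R τ n N = τ (R + 2) 0 := if_neg (by omega)
  have hright' : ∀ j < N, rightRoots R τ n j = τ (n + j + 1) 1 := fun j hj => if_pos (by omega)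
  have hcol : ∀ k, 1 ≤ k → k ≤ R + 2 → k ≤ n ∨ (∃ j < N, k = n + j + 1) ∨ k = R + 1 ∨ k = R + 2 := by
    intro k h₁ h₂
    by_cases h : k ≤ n
    · exact Or.inl h
    · by_cases h' : k ≤ R
      · exact Or.inr (Or.inl ⟨k - n - 1, by omega, by omega⟩)
      · omega
  have hpair : ∀ j < N, ∏ a ∈ Finset.range (m (n + j + 1)), (X - C (τ (n + j + 1) a))
      = (X - C (leftRoots τ n j)) * (X - C (rightRoots R τ n j)) := fun j hj => by
    rw [hm₂ _ (by omega) (by omega), hright' j hj, leftRoots, Finset.prod_range_succ,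
      Finset.prod_range_one]
  constructor
  · rintro ⟨hh, ht⟩
    have hT : τ n 0 = H n := hh.formula n le_rfl
    refine ⟨⟨?_, ht.weight_ne_zero⟩, fun k hk₁ hk₂ => ?_⟩
    · rintro rfl
      have h₁ := ht.left_ne_zero
      have h₂ := ht.right_ne_zero
      rw [inducedWeight_zero, add_zero] at h₁ h₂
      exact ⟨h₁, h₂⟩
    · rcases hcol k hk₁ hk₂ with h | ⟨j, hj, rfl⟩ | rfl | rfl
      · rw [hm₁ k h, hexHead k h, Finset.prod_range_one, X_sub_C_eq_iff]
        exact hh.formula k h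
      · rw [hexPair j hj, hpair j hj, X_sub_C_mul_X_sub_C_eq_iff, ← hT]
        exact ⟨ht.sum j hj, ht.prod j hj⟩
      · rw [hm₃ _ (by omega), hexEnd _ (Or.inl rfl), Finset.prod_range_one, X_sub_C_eq_iff, ← hT,
          ← hleft]
        exact ht.last_left
      · rw [hm₃ _ (by omega), hexEnd _ (Or.inr rfl), Finset.prod_range_one, X_sub_C_eq_iff, ← hT,
          ← hright]
        exact ht.last_right
  · rintro ⟨⟨h₁, h₂⟩, h⟩
    have hh : HeadSolution n lam (tailWeight N w e f + 2) (fun k => τ k 0) := by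
      -- The last head weight is positive here, because the tail contributes at least 2.
      refine ⟨by omega, fun k hk => ?_⟩
      rcases Nat.eq_zero_or_pos k with rfl | hk₀
      · simpa using hτ₀
      · have := h k hk₀ (by omega)
        rwa [hm₁ k hk, hexHead k hk, Finset.prod_range_one, X_sub_C_eq_iff] at this
    have hT : τ n 0 = H n := hh.formula n le_rfl
    -- Each doubled color adds at least 1 to the induced weight, so with a pair present the branch
    -- labels may vanish.
    have hw₀ : N ≠ 0 → inducedWeight w N ≠ 0 := by
      intro hN₀
      rw [inducedWeight]
      omega
    have hpair' : ∀ j < N, leftRoots τ n j + rightRoots R τ n j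
        = tailSum N w e f j * tailPoint N w e f (H n) j ∧
        leftRoots τ n j * rightRoots R τ n j
          = tailProd N w e f j * tailPoint N w e f (H n) j ^ 2 := by
      intro j hj
      have := h (n + j + 1) (by omega) (by omega)
      rwa [hexPair j hj, hpair j hj, X_sub_C_mul_X_sub_C_eq_iff] at this
    refine ⟨hh, hh.ne_zero le_rfl, h₂, ?_, ?_, ?_, ?_, ?_, ?_⟩
    · by_cases hN₀ : N = 0
      · have := (h₁ hN₀).1
        simp only [e] at this
        omega
      · have := hw₀ hN₀
        omega
    · by_cases hN₀ : N = 0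
      · have := (h₁ hN₀).2
        simp only [f] at this
        omega
      · have := hw₀ hN₀
        omega
    · intro j hj
      rw [hT]
      exact (hpair' j hj).1
    · intro j hj
      rw [hT]
      exact (hpair' j hj).2
    · have := h (R + 1) (by omega) (by omega)
      rw [hm₃ _ (by omega), hexEnd _ (Or.inl rfl), Finset.prod_range_one, X_sub_C_eq_iff] at this
      rw [hT, hleft]
      exact this
    · have := h (R + 2) (by omega) (by omega)
      rw [hm₃ _ (by omega), hexEnd _ (Or.inr rfl), Finset.prod_range_one, X_sub_C_eq_iff] at this
      rw [hT, hright]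
      exact this

/-- The solutions of the Bethe ansatz equation are the points that represent the explicit tuple of
polynomials, if the length is admissible. -/
theorem isSolutionD_iff_explicit {r : ℕ} (hr : 4 ≤ r) {wt : Weight r}
    (hwt : IsDominantIntegral wt) (L : LengthD r) (t : Var L.tuple → ℂ) :
    IsSolutionD wt L.tuple t ↔ IsAdmissible wt L ∧
      ∀ i : Fin r, representingPoly t i = explicitPoly wt L (i + 1) := by
  obtain ⟨R, rfl⟩ : ∃ R, r = R + 2 := ⟨r - 2, by omega⟩
  have hR : 2 ≤ R := by omega
  choose c hc using hwt
  obtain ⟨lam, hlam⟩ : ∃ lam : ℕ → ℕ, ∀ i, wt i = lam (i + 1) :=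
    ⟨fun k => if h : k - 1 < R + 2 then c ⟨k - 1, h⟩ else 0, fun i => by simp [hc]⟩
  cases L with
  | bar => exact isSolutionD_iff_bar hR hlam t
  | ord l hl =>
    rcases Nat.lt_trichotomy l (R + 1) with h | rfl | h
    · exact isSolutionD_iff_of_le hR hlam (by omega) hl t
    · exact isSolutionD_iff_pred hR hlam hl t
    -- n = 2r - 2 - l is the number of single colors at the start and N = l - r the number of
    -- doubled ones.
    · obtain ⟨n, N, hN, rfl⟩ : ∃ n N, n + N = R ∧ l = n + 2 * N + 2 :=
        ⟨2 * R + 2 - l, l - R - 2, by omega, by omega⟩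
      exact isSolutionD_iff_of_tail hR hlam hN hl t

end BetheAnsatz

end

/-! ### Existence and uniqueness of the orbit -/

theorem mainTheorem8 (r : ℕ) (hr : 4 ≤ r) (lam : BetheAnsatz.Weight r)
    (hlam : BetheAnsatz.IsDominantIntegral lam) (L : BetheAnsatz.LengthD r) :
    (¬ BetheAnsatz.IsAdmissible lam L →
      ¬ ∃ t : BetheAnsatz.Var L.tuple → ℂ, BetheAnsatz.IsSolutionD lam L.tuple t) ∧
    (BetheAnsatz.IsAdmissible lam L →
      ∃ t : BetheAnsatz.Var L.tuple → ℂ,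
        BetheAnsatz.IsSolutionD lam L.tuple t ∧
        (∀ i : Fin r,
          BetheAnsatz.representingPoly t i = BetheAnsatz.explicitPoly lam L (i.val + 1)) ∧
        ∀ t' : BetheAnsatz.Var L.tuple → ℂ,
          BetheAnsatz.IsSolutionD lam L.tuple t' → BetheAnsatz.SameOrbit t t') := by
  have key := BetheAnsatz.isSolutionD_iff_explicit hr hlam L
  refine ⟨fun h ⟨t, ht⟩ => h ((key t).1 ht).1, fun h => ?_⟩
  -- The explicit polynomials are monic of the prescribed degrees, so over ℂ their roots provide a
  -- point with the right number of variables of each color.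
  choose f hf using fun i => BetheAnsatz.exists_eq_prod_X_sub_C
    (BetheAnsatz.explicitPoly_monic_natDegree hr lam L i).1
    (BetheAnsatz.explicitPoly_monic_natDegree hr lam L i).2
  let t : BetheAnsatz.Var L.tuple → ℂ := fun p => f p.1 p.2
  have ht : ∀ i, BetheAnsatz.representingPoly t i = BetheAnsatz.explicitPoly lam L (i + 1) := hf
  refine ⟨t, (key t).2 ⟨h, ht⟩, ht, fun t' ht' => ?_⟩
  exact BetheAnsatz.sameOrbit_of_representingPoly_eq fun i =>
    (ht i).trans (((key t').1 ht').2 i).symm
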